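/- Consider a dual-hop amplify-and-forward link: a single-antenna source, a relay with $N$ antennas, a single-antenna destination, and $M$ interferers at the relay, $N>M$. The source-relay channel $\mathbf h_1\in\mathbb C^{N}$, the interference channel matrix $\mathbf H_I=[\mathbf h_{I1},\dots,\mathbf h_{IM}]\in\mathbb C^{N\times M}$ and the relay-destination channel $\mathbf h_2\in\mathbb C^N$ have jointly independent $\mathcal{CN}(0,1)$ entries. Let $P,P_r,N_0>0$ be the source power, relay power and noise power, $P_{Ii}\ge 0$ the interference powers, $\rho_1=P/N_0$, $\rho_2=P_r/N_0$. For a relay matrix $\mathbf W\in\mathbb C^{N\times N}$ the end-to-end SINR is $$\gamma=\frac{|\mathbf h_2^\dagger \mathbf W\mathbf h_1|^2P}{\sum_{i=1}^M|\mathbf h_2^\dagger \mathbf W\mathbf h_{Ii}|^2P_{Ii}+\|\mathbf h_2^\dagger \mathbf W\|^2N_0+N_0}.$$ The ZF/MRT scheme uses $\mathbf W=\omega\frac{\mathbf h_2}{\|\mathbf h_2\|}\mathbf w_1$ with $\mathbf w_1=\frac{\mathbf h_1^\dagger\mathbf P}{\sqrt{\mathbf h_1^\dagger\mathbf P\mathbf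 h_1}}$, $\mathbf P=\mathbf I_N-\mathbf H_I(\mathbf H_I^\dagger\mathbf H_I)^{-1}\mathbf H_I^\dagger$ and $\omega^2=\frac{\rho_2}{|\mathbf w_1\mathbf h_1|^2\rho_1+1}$; denote its SINR by $\gamma_{\sf ZF}$. Then $\log_2(1+\gamma_{\sf ZF})$ is integrable and the ergodic capacity $C_{\sf ZF}=\frac12\mathrm E[\log_2(1+\gamma_{\sf ZF})]$ equals $$C_{\sf ZF}=\frac1{2\ln2}\Bigg(\sum_{k=0}^{N-M-1}\frac{e^{1/\rho_1}}{\rho_1^k}\Gamma\Big(-k,\frac1{\rho_1}\Big)+\sum_{j=0}^{N-1}\frac{e^{1/\rho_2}}{\rho_2^j}\Gamma\Big(-j,\frac1{\rho_2}\Big)-\sum_{k=0}^{N-M-1}\Psi\Big(1,1-k;\frac1{\rho_1}\Big)-\sum_{j=0}^{N-1}\Psi\Big(1,1-j;\frac1{\rho_2}\Big)+\rho_1\rho_2\sum_{k=0}^{N-M-1}\sum_{j=0}^{N-1}\frac{1}{k!\,j!}\,G_{k,j}(\rho_1,\rho_2)\Bigg).$$ Here $\Gamma(\alpha,x)=\int_x^\infty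 t^{\alpha-1}e^{-t}\,dt$. $\Psi(a,b;z)$ is Tricomi's confluent hypergeometric function, that is, $\frac{\Gamma(1-b)}{\Gamma(a-b+1)}\Phi(a,b;z)+\frac{\Gamma(b-1)}{\Gamma(a)}z^{1-b}\Phi(a-b+1,2-b;z)$ with Kummer's series $\Phi(a,b;z)=\sum_{n\ge0}\frac{(a)_n}{(b)_n}\frac{z^n}{n!}$, extended to integer $b$ by continuity. $G_{k,j}(x,y)$ is the generalized Meijer G-function of two variables ${\rm G}_{1,[1:1],0,[1:1]}^{1,1,1,1,1}$ with parameters $2;\,-k;\,-j;\,-;\,0;\,0$, that is, the absolutely convergent integral $$G_{k,j}(x,y)=\frac1{(2\pi i)^2}\int_{\sigma-i\infty}^{\sigma+i\infty}\int_{\tau-i\infty}^{\tau+i\infty}\Gamma(2+\xi+\eta)\,\Gamma(1+k+\xi)\Gamma(-\xi)\,\Gamma(1+j+\eta)\Gamma(-\eta)\,x^{\xi}y^{\eta}\,d\eta\,d\xi ,$$ for any real $\sigma,\tau$ with $-k-1<\sigma<0$, $-j-1<\tau<0$, $\sigma+\tau>-2$. -/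

import Mathlib

open MeasureTheory ProbabilityTheory Filter Topology

noncomputable section

/-! ### Special functions -/

/-- The upper incomplete gamma function `Γ(α, x) = ∫_x^∞ t^(α-1) e^(-t) dt`
(`α` real, possibly negative, `x > 0`). -/
def upperIncompleteGamma (α x : ℝ) : ℝ :=
  ∫ t in Set.Ioi x, t ^ (α - 1) * Real.exp (-t)

/-- Kummer's confluent hypergeometric series `Φ(a, b; z) = ∑ (a)_n / (b)_n * z^n / n!`
(for `b` not a nonpositive integer). -/
def kummerPhi (a b z : ℝ) : ℝ :=
  ∑' n : ℕ, (ascPochhammer ℝ n).eval a / (ascPochhammer ℝ n).eval b * (z ^ n / (n.factorial : ℝ))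

/-- The right-hand side of
`Ψ(a, b; z) = Γ(1-b)/Γ(a-b+1) Φ(a, b; z) + Γ(b-1)/Γ(a) z^(1-b) Φ(a-b+1, 2-b; z)`,
which defines `Ψ` for non-integer `b`. -/
def tricomiPsiNonint (a b z : ℝ) : ℝ :=
  Real.Gamma (1 - b) / Real.Gamma (a - b + 1) * kummerPhi a b z
    + Real.Gamma (b - 1) / Real.Gamma a * z ^ (1 - b) * kummerPhi (a - b + 1) (2 - b) z

/-- Tricomi's confluent hypergeometric function `Ψ(a, b; z)`, `z > 0`: the continuous extension
in `b`, to all real `b` including the integers, of the formula above. -/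
def tricomiPsi (a b z : ℝ) : ℝ :=
  limUnder (𝓝[≠] b) fun c => tricomiPsiNonint a c z

/-- The Mellin-Barnes integrand of the generalized Meijer G-function of two variables
`G_{1,[1:1],0,[1:1]}^{1,1,1,1,1}(x, y | a; c; c'; -; b; b')`. -/
def meijerG2Integrand (a c c' b b' x y : ℝ) (ξ η : ℂ) : ℂ :=
  Complex.Gamma (a + ξ + η)
    * (Complex.Gamma (1 - c + ξ) * Complex.Gamma (b - ξ))
    * (Complex.Gamma (1 - c' + η) * Complex.Gamma (b' - η))
    * (x : ℂ) ^ ξ * (y : ℂ) ^ η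

/-- The vertical lines `Re ξ = σ`, `Re η = τ` are admissible contours: they separate the poles of
`Γ(1-c+ξ)` from those of `Γ(b-ξ)`, the poles of `Γ(1-c'+η)` from those of `Γ(b'-η)`, and
they leave the poles of `Γ(a+ξ+η)` on the left. -/
def IsMeijerG2Contour (a c c' b b' σ τ : ℝ) : Prop :=
  c - 1 < σ ∧ σ < b ∧ c' - 1 < τ ∧ τ < b' ∧ 0 < a + σ + τ

/-- The integrand above on the pair of contours `ξ = σ + i p.1`, `η = τ + i p.2`. -/
def meijerG2OnContour (σ τ a c c' b b' x y : ℝ) (p : ℝ × ℝ) : ℂ :=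
  meijerG2Integrand a c c' b b' x y (σ + p.1 * Complex.I) (τ + p.2 * Complex.I)

/-- The generalized Meijer G-function of two variables
`G_{1,[1:1],0,[1:1]}^{1,1,1,1,1}(x, y | a; c; c'; -; b; b')`, i.e. `(2πi)^(-2) ∬ ... dξ dη`
over `Re ξ = σ`, `Re η = τ`; here `dξ dη = i^2 dp`. -/
def meijerG2 (σ τ a c c' b b' x y : ℝ) : ℂ :=
  (1 / (2 * (Real.pi : ℂ) * Complex.I)) ^ 2
    * ∫ p : ℝ × ℝ, meijerG2OnContour σ τ a c c' b b' x y p * Complex.I ^ 2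

/-! ### The dual-hop relaying system -/

/-- The circularly symmetric complex Gaussian law `CN(0,1)`: independent real and imaginary parts
of law `N(0, 1/2)`. -/
def complexNormal : Measure ℂ :=
  ((gaussianReal 0 (1 / 2)).prod (gaussianReal 0 (1 / 2))).map
    fun p : ℝ × ℝ => (p.1 : ℂ) + (p.2 : ℂ) * Complex.I

/-- The squared Euclidean (Frobenius) norm of a vector. -/
def normSqF {N : ℕ} (v : Fin N → ℂ) : ℝ := ∑ n, ‖v n‖ ^ 2

/-- All scalar channel coefficients as one family: the entries of the source-relay channel `h₁`,
of the interference channel matrix `H` (column `i` is the channel of interferer `i`) and of the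
relay-destination channel `h₂`. -/
def channelEntry {Ω : Type*} {N M : ℕ} (h₁ : Ω → Fin N → ℂ)
    (H : Ω → Matrix (Fin N) (Fin M) ℂ) (h₂ : Ω → Fin N → ℂ) :
    Fin N ⊕ (Fin N × Fin M) ⊕ Fin N → Ω → ℂ
  | Sum.inl n, ω => h₁ ω n
  | Sum.inr (Sum.inl q), ω => H ω q.1 q.2
  | Sum.inr (Sum.inr n), ω => h₂ ω n

/-- `P = I - H (H† H)⁻¹ H†`. -/
def zfProjection {N M : ℕ} (H : Matrix (Fin N) (Fin M) ℂ) : Matrix (Fin N) (Fin N) ℂ :=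
  1 - H * (H.conjTranspose * H)⁻¹ * H.conjTranspose

/-- The ZF combining row vector `w₁ = h₁† P / √(h₁† P h₁)`
(the number `h₁† P h₁` is real and nonnegative). -/
def zfCombiner {N M : ℕ} (h₁ : Fin N → ℂ) (H : Matrix (Fin N) (Fin M) ℂ) : Fin N → ℂ :=
  ((Real.sqrt (star h₁ ⬝ᵥ (zfProjection H).mulVec h₁).re : ℂ))⁻¹ •
    (zfProjection H).vecMul (star h₁)

/-- The power constraint factor `ω² = ρ₂ / (|w₁ h₁|² ρ₁ + 1)` of the ZF/MRT scheme. -/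
def zfPowerFactorSq {N M : ℕ} (ρ₁ ρ₂ : ℝ) (h₁ : Fin N → ℂ)
    (H : Matrix (Fin N) (Fin M) ℂ) : ℝ :=
  ρ₂ / (‖zfCombiner h₁ H ⬝ᵥ h₁‖ ^ 2 * ρ₁ + 1)

/-- The relay matrix `W = ω (h₂ / ‖h₂‖) w₁` of the ZF/MRT scheme. -/
def zfRelayMatrix {N M : ℕ} (ρ₁ ρ₂ : ℝ) (h₁ : Fin N → ℂ)
    (H : Matrix (Fin N) (Fin M) ℂ) (h₂ : Fin N → ℂ) : Matrix (Fin N) (Fin N) ℂ :=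
  (Real.sqrt (zfPowerFactorSq ρ₁ ρ₂ h₁ H) : ℂ) •
    Matrix.vecMulVec ((Real.sqrt (normSqF h₂) : ℂ)⁻¹ • h₂) (zfCombiner h₁ H)

/-- The end-to-end signal-to-interference-and-noise ratio for source power `P`, interference
powers `PI i`, noise power `N₀` and relay matrix `W`:
`|h₂† W h₁|² P / (∑ |h₂† W h_{Ii}|² P_{Ii} + ‖h₂† W‖² N₀ + N₀)`. -/
def endToEndSINR {N M : ℕ} (P N₀ : ℝ) (PI : Fin M → ℝ) (h₁ : Fin N → ℂ)
    (H : Matrix (Fin N) (Fin M) ℂ) (h₂ : Fin N → ℂ) (W : Matrix (Fin N) (Fin N) ℂ) : ℝ :=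
  ‖star h₂ ⬝ᵥ W.mulVec h₁‖ ^ 2 * P /
    (∑ i, ‖star h₂ ⬝ᵥ W.mulVec (fun n => H n i)‖ ^ 2 * PI i
      + normSqF (W.vecMul (star h₂)) * N₀ + N₀)

/-- The end-to-end SINR of the ZF/MRT scheme with source power `P`, relay power `Pr`,
interference powers `PI i` and noise power `N₀`. -/
def zfSINR {N M : ℕ} (P Pr N₀ : ℝ) (PI : Fin M → ℝ) (h₁ : Fin N → ℂ)
    (H : Matrix (Fin N) (Fin M) ℂ) (h₂ : Fin N → ℂ) : ℝ :=
  endToEndSINR P N₀ PI h₁ H h₂ (zfRelayMatrix (P / N₀) (Pr / N₀) h₁ H h₂)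

/-- The instantaneous mutual information without the two-slot factor, `log₂(1 + γ)`. -/
def mutualInfo {Ω : Type*} (γ : Ω → ℝ) (ω : Ω) : ℝ := Real.logb 2 (1 + γ ω)

/-- The ergodic capacity `C = (1/2) E[log₂(1 + γ)]` of a two-slot link with random SINR `γ`. -/
def ergodicCapacity {Ω : Type*} [MeasurableSpace Ω] (μ : Measure Ω) (γ : Ω → ℝ) : ℝ :=
  1 / 2 * ∫ ω, mutualInfo γ ω ∂μ

end

/-! The four single sums cancel termwise. At `a = 1` the second Kummer series in Ψ is exponential
and the first is the series of the lower incomplete gamma function, so Ψ(1, 1-k; z) = e^z z^k Γ(-k,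
z). Only the double sum carries the capacity.

When H†H is invertible, which holds almost surely, P is a Hermitian projection annihilating H. The
interference disappears and γ = ab/(1+a+b) with a = ρ₁ h₁†Ph₁ and b = ρ₂‖h₂‖² (`zfSINR_eq`). Then
1+γ = (1+a)(1+b)/(1+a+b), and Frullani's integral turns log(1+γ) into ∫₀^∞ e^(-t)/t
(1-e^(-at))(1-e^(-bt)) dt (`lintegral_exp_div_mul_one_sub_exp`). The integrand is nonnegative and
separates a from b, so Tonelli and independence reduce its mean to Laplace transforms. These come
from the Gaussian integral and det(1+sP) = (1+s)^(N-M), with no density of the gains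
(`lintegral_exp_neg_zfGain`).

Since 1-(1+s)^(-m) = s ∑_{k<m} (1+s)^(-k-1), the mean is ρ₁ρ₂ times a double sum of integrals of t
e^(-t) (1+ρ₁t)^(-k-1) (1+ρ₂t)^(-j-1). Each is G_{k,j}/(k! j!): write Γ(2+ξ+η) as Euler's integral,
exchange the integrals, and evaluate the contour integrals by the Mellin-Barnes formula for
(1+x)^(-a) (`meijerG2_eq_integral`). -/

noncomputable section

/-! ### Incomplete gamma functions and Tricomi's function at `a = 1` -/

theorem integrableOn_rpow_mul_exp_neg_Ioi (s : ℝ) {z : ℝ} (hz : 0 < z) :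
    IntegrableOn (fun t : ℝ => t ^ (s - 1) * Real.exp (-t)) (Set.Ioi z) := by
  refine integrable_of_isBigO_exp_neg (b := 1 / 2) (by norm_num) ?_ ?_
  · intro t ht
    have : t ≠ 0 := (hz.trans_le ht).ne'
    exact ((Real.continuousAt_rpow_const t (s - 1) (Or.inl this)).mul
      (by fun_prop)).continuousWithinAt
  · refine (Real.Gamma_integrand_isLittleO (s - 1)).isBigO.congr_left fun t => ?_
    ring

theorem upperIncompleteGamma_add_one (s : ℝ) {z : ℝ} (hz : 0 < z) :
    upperIncompleteGamma (s + 1) z = s * upperIncompleteGamma s z + z ^ s * Real.exp (-z) := by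
  have hi := integrableOn_rpow_mul_exp_neg_Ioi (s + 1) hz
  have hi' := (integrableOn_rpow_mul_exp_neg_Ioi s hz).const_mul s
  have hd : ∀ t ∈ Set.Ici z, HasDerivAt (fun t : ℝ => -(t ^ s * Real.exp (-t)))
      (t ^ (s + 1 - 1) * Real.exp (-t) - s * (t ^ (s - 1) * Real.exp (-t))) t := by
    intro t ht
    have ht0 : t ≠ 0 := (hz.trans_le ht).ne'
    have h1 := Real.hasDerivAt_rpow_const (x := t) (p := s) (Or.inl ht0)
    have h2 : HasDerivAt (fun t : ℝ => Real.exp (-t)) (-Real.exp (-t)) t := by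
      simpa using (hasDerivAt_neg t).exp
    have h3 := (h1.mul h2).neg
    refine h3.congr_deriv ?_
    rw [add_sub_cancel_right]
    ring
  have hlim : Tendsto (fun t : ℝ => -(t ^ s * Real.exp (-t))) atTop (𝓝 0) := by
    have := (tendsto_rpow_mul_exp_neg_mul_atTop_nhds_zero s 1 one_pos).neg
    simpa using this
  have key := integral_Ioi_of_hasDerivAt_of_tendsto' hd (hi.sub hi') hlim
  rw [integral_sub hi hi', integral_const_mul] at key
  unfold upperIncompleteGamma
  linarith

theorem Gamma_sub_upperIncompleteGamma_bounds {s z : ℝ} (hs : 0 < s) (hz : 0 < z) :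
    0 ≤ Real.Gamma s - upperIncompleteGamma s z ∧
      Real.Gamma s - upperIncompleteGamma s z ≤ z ^ s / s := by
  have hint : IntegrableOn (fun t : ℝ => t ^ (s - 1) * Real.exp (-t)) (Set.Ioi 0) :=
    (Real.GammaIntegral_convergent hs).congr_fun (fun t _ => mul_comm _ _) measurableSet_Ioi
  have hG : Real.Gamma s = ∫ t in Set.Ioi (0 : ℝ), t ^ (s - 1) * Real.exp (-t) := by
    rw [Real.Gamma_eq_integral hs]
    exact setIntegral_congr_fun measurableSet_Ioi fun t _ => mul_comm _ _
  have hioc : IntegrableOn (fun t : ℝ => t ^ (s - 1) * Real.exp (-t)) (Set.Ioc 0 z) :=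
    hint.mono_set Set.Ioc_subset_Ioi_self
  have hsplit : Real.Gamma s - upperIncompleteGamma s z
      = ∫ t in Set.Ioc 0 z, t ^ (s - 1) * Real.exp (-t) := by
    rw [hG, upperIncompleteGamma, ← Set.Ioc_union_Ioi_eq_Ioi hz.le,
      setIntegral_union (Set.Ioc_disjoint_Ioi le_rfl) measurableSet_Ioi hioc
        (integrableOn_rpow_mul_exp_neg_Ioi s hz)]
    ring
  rw [hsplit]
  constructor
  · refine setIntegral_nonneg measurableSet_Ioc fun t ht => ?_
    have := ht.1.le
    positivity
  · have hpow : IntervalIntegrable (fun t : ℝ => t ^ (s - 1)) volume 0 z :=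
      intervalIntegral.intervalIntegrable_rpow' (by linarith)
    have h0 : ∫ t in Set.Ioc 0 z, t ^ (s - 1) = z ^ s / s := by
      rw [← intervalIntegral.integral_of_le hz.le, integral_rpow (Or.inl (by linarith))]
      simp [Real.zero_rpow hs.ne']
    rw [← h0]
    refine setIntegral_mono_on hioc ((intervalIntegrable_iff_integrableOn_Ioc_of_le hz.le).1 hpow)
      measurableSet_Ioc fun t ht => ?_
    have h1 : Real.exp (-t) ≤ 1 := Real.exp_le_one_iff.2 (by linarith [ht.1])
    have h2 : 0 ≤ t ^ (s - 1) := Real.rpow_nonneg ht.1.le _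
    exact mul_le_of_le_one_right h2 h1

theorem ascPochhammer_eval_ne_zero {b : ℝ} (hb : ∀ m : ℕ, b ≠ -m) (n : ℕ) :
    (ascPochhammer ℝ n).eval b ≠ 0 := by
  induction n with
  | zero => simp
  | succ n ih =>
    rw [ascPochhammer_succ_eval]
    refine mul_ne_zero ih fun h => hb n ?_
    linarith

theorem summable_pow_div_ascPochhammer {b : ℝ} (hb : ∀ m : ℕ, b ≠ -m) {z : ℝ} (hz : 0 < z) :
    Summable fun n : ℕ => z ^ n / (ascPochhammer ℝ n).eval b := by
  refine summable_of_ratio_test_tendsto_lt_one (l := 0) one_pos ?_ ?_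
  · exact Eventually.of_forall fun n =>
      div_ne_zero (pow_ne_zero _ hz.ne') (ascPochhammer_eval_ne_zero hb n)
  · have h : Tendsto (fun n : ℕ => ‖z / (b + n)‖) atTop (𝓝 0) := by
      rw [← norm_zero (E := ℝ)]
      exact (tendsto_const_nhds.div_atTop
        (tendsto_atTop_add_const_left _ _ tendsto_natCast_atTop_atTop)).norm
    refine h.congr fun n => ?_
    have h1 := ascPochhammer_eval_ne_zero hb n
    have h2 : b + n ≠ 0 := fun h => hb n (by linarith)
    rw [← norm_div, ascPochhammer_succ_eval]
    congr 1
    field_simp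
    ring

/-- Iterating the two recurrences in `s` works for negative non-integer `s` too, where Γ(s) is not
Euler's integral; the remainder sits at `s + n`, which is eventually positive. -/
theorem Gamma_sub_upperIncompleteGamma_eq_sum {s z : ℝ} (hs : ∀ m : ℕ, s ≠ -m) (hz : 0 < z)
    (n : ℕ) :
    Real.Gamma s - upperIncompleteGamma s z =
      ∑ i ∈ Finset.range n,
          z ^ s * Real.exp (-z) * (z ^ i / (ascPochhammer ℝ (i + 1)).eval s)
        + (Real.Gamma (s + n) - upperIncompleteGamma (s + n) z)
          / (ascPochhammer ℝ n).eval s := by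
  induction n with
  | zero => simp
  | succ n ih =>
    have h2 : s + n ≠ 0 := fun h => hs n (by linarith)
    have h1 := ascPochhammer_eval_ne_zero hs n
    rw [ih, Finset.sum_range_succ, add_assoc]
    congr 1
    push_cast
    rw [← add_assoc, Real.Gamma_add_one h2, upperIncompleteGamma_add_one _ hz,
      ascPochhammer_succ_eval, Real.rpow_add hz, Real.rpow_natCast]
    field_simp
    ring

theorem Gamma_sub_upperIncompleteGamma_eq_tsum {s z : ℝ} (hs : ∀ m : ℕ, s ≠ -m) (hz : 0 < z) :
    Real.Gamma s - upperIncompleteGamma s z =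
      z ^ s * Real.exp (-z) / s * ∑' n : ℕ, z ^ n / (ascPochhammer ℝ n).eval (s + 1) := by
  have hs0 : s ≠ 0 := by simpa using hs 0
  have hs1 : ∀ m : ℕ, s + 1 ≠ -m := fun m h => hs (m + 1) (by push_cast; linarith)
  have hpoch : ∀ i : ℕ, (ascPochhammer ℝ (i + 1)).eval s = s * (ascPochhammer ℝ i).eval (s + 1) := by
    intro i
    rw [ascPochhammer_succ_left]
    simp [Polynomial.eval_comp]
  have hsum := (summable_pow_div_ascPochhammer hs1 hz).mul_left (z ^ s * Real.exp (-z) / s)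
  have hterm : ∀ i : ℕ, z ^ s * Real.exp (-z) / s * (z ^ i / (ascPochhammer ℝ i).eval (s + 1))
      = z ^ s * Real.exp (-z) * (z ^ i / (ascPochhammer ℝ (i + 1)).eval s) := by
    intro i
    have := ascPochhammer_eval_ne_zero hs1 i
    rw [hpoch]
    field_simp
  have hlim := hsum.hasSum.tendsto_sum_nat
  rw [tsum_mul_left] at hlim
  have hrem : Tendsto (fun n : ℕ => (Real.Gamma (s + n) - upperIncompleteGamma (s + n) z)
      / (ascPochhammer ℝ n).eval s) atTop (𝓝 0) := by
    have h0 := ((summable_pow_div_ascPochhammer hs hz).tendsto_atTop_zero.norm).const_mul (z ^ s)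
    rw [norm_zero, mul_zero] at h0
    refine squeeze_zero_norm' ?_ h0
    -- Once `s + n ≥ 1`, the integral bound z^(s+n)/(s+n) applies and its divisor can be dropped,
    -- leaving z^s times a term of a convergent series.
    filter_upwards [eventually_ge_atTop (⌈1 - s⌉₊)] with n hn
    have hn1 : 1 ≤ s + n := by
      have := (Nat.le_ceil (1 - s)).trans (Nat.cast_le.2 hn)
      linarith
    have hb := Gamma_sub_upperIncompleteGamma_bounds (s := s + n) (by linarith) hz
    rw [norm_div, norm_div, Real.norm_of_nonneg hb.1, Real.norm_of_nonneg (pow_nonneg hz.le n),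
      ← mul_div_assoc]
    gcongr
    refine hb.2.trans ((div_le_self (by positivity) hn1).trans ?_)
    rw [Real.rpow_add hz, Real.rpow_natCast]
  have h2 := hlim.add hrem
  rw [add_zero] at h2
  refine tendsto_nhds_unique (tendsto_const_nhds.congr fun n => ?_) h2
  rw [Gamma_sub_upperIncompleteGamma_eq_sum hs hz n]
  simp_rw [hterm]

theorem kummerPhi_self {b : ℝ} (hb : ∀ m : ℕ, b ≠ -m) (z : ℝ) : kummerPhi b b z = Real.exp z := by
  rw [kummerPhi, Real.exp_eq_exp_ℝ, NormedSpace.exp_eq_tsum_div]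
  refine tsum_congr fun n => ?_
  rw [div_self (ascPochhammer_eval_ne_zero hb n), one_mul]

theorem kummerPhi_one_left (b z : ℝ) :
    kummerPhi 1 b z = ∑' n : ℕ, z ^ n / (ascPochhammer ℝ n).eval b := by
  refine tsum_congr fun n => ?_
  have : (n.factorial : ℝ) ≠ 0 := by positivity
  rw [ascPochhammer_eval_one]
  field_simp

/-- Here Φ(2-b, 2-b; z) = e^z, Φ(1, b; z) is the series of the lower incomplete gamma function at
b-1, and Γ(1-b)/Γ(2-b) = -1/(b-1). The lower part is therefore subtracted from Γ(b-1), which leaves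
the upper part. -/
theorem tricomiPsiNonint_one {b z : ℝ} (hb : ∀ m : ℤ, b ≠ m) (hz : 0 < z) :
    tricomiPsiNonint 1 b z = Real.exp z * z ^ (1 - b) * upperIncompleteGamma (b - 1) z := by
  have h1 : ∀ m : ℕ, b - 1 ≠ -m := fun m h => hb (1 - m) (by push_cast; linarith)
  have h2 : ∀ m : ℕ, 2 - b ≠ -m := fun m h => hb (2 + m) (by push_cast; linarith)
  have h3 : ∀ m : ℕ, 1 - b ≠ -m := fun m h => hb (1 + m) (by push_cast; linarith)
  have h4 : 1 - b ≠ 0 := by simpa using h3 0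
  have h4' : b - 1 ≠ 0 := by simpa using h1 0
  have hG : Real.Gamma (1 - b) ≠ 0 := Real.Gamma_ne_zero h3
  have hD := Gamma_sub_upperIncompleteGamma_eq_tsum h1 hz
  rw [sub_add_cancel, ← kummerPhi_one_left] at hD
  have hD' : upperIncompleteGamma (b - 1) z = Real.Gamma (b - 1)
      - z ^ (b - 1) * Real.exp (-z) / (b - 1) * kummerPhi 1 b z := by linarith
  rw [hD', tricomiPsiNonint, show (1 : ℝ) - b + 1 = 2 - b by ring, kummerPhi_self h2,
    show (2 : ℝ) - b = (1 - b) + 1 by ring, Real.Gamma_add_one h4, Real.Gamma_one]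
  have e1 : z ^ (1 - b) * z ^ (b - 1) = 1 := by
    rw [← Real.rpow_add hz]; simp
  have e2 : Real.exp z * Real.exp (-z) = 1 := by rw [← Real.exp_add]; simp
  have e3 : Real.Gamma (1 - b) / ((1 - b) * Real.Gamma (1 - b)) = -(1 / (b - 1)) := by
    rw [← neg_sub b 1]
    rw [← neg_sub b 1] at hG
    field_simp
  rw [e3]
  linear_combination (kummerPhi 1 b z / (b - 1)) * (Real.exp z * Real.exp (-z)) * e1
    + (kummerPhi 1 b z / (b - 1)) * e2

theorem continuous_upperIncompleteGamma_left {z : ℝ} (hz : 0 < z) :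
    Continuous fun s => upperIncompleteGamma s z := by
  rw [continuous_iff_continuousAt]
  intro s₀
  refine continuousAt_of_dominated
    -- For |s - s₀| < 1 the power t^(s-1) lies below the larger exponent's power when t ≥ 1 and
    -- below the smaller one's when t ≤ 1; the sum covers both cases.
    (bound := fun t => t ^ ((s₀ + 1) - 1) * Real.exp (-t) + t ^ ((s₀ - 1) - 1) * Real.exp (-t))
    ?_ ?_ ?_ ?_
  · exact Eventually.of_forall fun s => (integrableOn_rpow_mul_exp_neg_Ioi s hz).1
  · filter_upwards [Metric.ball_mem_nhds s₀ one_pos] with s hs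
    rw [Metric.mem_ball, Real.dist_eq, abs_lt] at hs
    refine (ae_restrict_mem measurableSet_Ioi).mono fun t ht => ?_
    have ht0 : 0 < t := hz.trans ht
    rw [Real.norm_of_nonneg (by positivity), ← add_mul]
    gcongr
    rcases le_total 1 t with h | h
    · exact (Real.rpow_le_rpow_of_exponent_le h (by linarith)).trans
        (le_add_of_nonneg_right (by positivity))
    · exact (Real.rpow_le_rpow_of_exponent_ge ht0 h (by linarith)).trans
        (le_add_of_nonneg_left (by positivity))
  · exact (integrableOn_rpow_mul_exp_neg_Ioi _ hz).add (integrableOn_rpow_mul_exp_neg_Ioi _ hz)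
  · refine (ae_restrict_mem measurableSet_Ioi).mono fun t ht => ?_
    have ht0 : 0 < t := hz.trans ht
    exact (((Real.continuous_const_rpow ht0.ne').comp (continuous_sub_right 1)).mul
      continuous_const).continuousAt

theorem tricomiPsi_one_intCast (b : ℤ) {z : ℝ} (hz : 0 < z) :
    tricomiPsi 1 b z = Real.exp z * z ^ (1 - (b : ℝ)) * upperIncompleteGamma (b - 1) z := by
  refine Tendsto.limUnder_eq ?_
  have hc : Continuous fun c : ℝ =>
      Real.exp z * z ^ (1 - c) * upperIncompleteGamma (c - 1) z := by
    have h1 := (continuous_upperIncompleteGamma_left hz).comp (continuous_sub_right 1)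
    have h2 := (Real.continuous_const_rpow hz.ne').comp (continuous_sub_left 1)
    exact (continuous_const.mul h2).mul h1
  refine ((hc.tendsto b).mono_left nhdsWithin_le_nhds).congr' ?_
  -- The unit ball around the integer `b` contains no other integer, so the non-integer formula
  -- holds on its punctured version.
  filter_upwards [self_mem_nhdsWithin, mem_nhdsWithin_of_mem_nhds
    (Metric.ball_mem_nhds (b : ℝ) one_pos)] with c hc1 hc2
  refine (tricomiPsiNonint_one (fun m hm => hc1 ?_) hz).symm
  rw [Metric.mem_ball, Real.dist_eq, hm] at hc2
  have : |m - b| < 1 := by exact_mod_cast hc2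
  have hmb : m = b := by rw [Int.abs_lt_one_iff] at this; omega
  simp [hm, hmb]

/-- At `a = 1`, `b = 1 - k`, Tricomi's function is an incomplete gamma function. -/
theorem tricomiPsi_one_one_sub_natCast (k : ℕ) {ρ : ℝ} (hρ : 0 < ρ) :
    tricomiPsi 1 (1 - (k : ℝ)) (1 / ρ) =
      Real.exp (1 / ρ) / ρ ^ k * upperIncompleteGamma (-(k : ℝ)) (1 / ρ) := by
  have h := tricomiPsi_one_intCast (1 - k) (z := 1 / ρ) (by positivity)
  push_cast at h
  rw [h, sub_sub_cancel, Real.rpow_natCast, show (1 : ℝ) - k - 1 = -k by ring]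
  simp [div_eq_mul_inv]

/-! ### Mellin-Barnes representation of `(1 + x)⁻ᵃ` -/

theorem norm_Gamma_le_Gamma_re {s : ℂ} (hs : 0 < s.re) : ‖Complex.Gamma s‖ ≤ Real.Gamma s.re := by
  rw [Complex.Gamma_eq_integral hs, Real.Gamma_eq_integral hs, Complex.GammaIntegral]
  refine (norm_integral_le_integral_norm _).trans_eq ?_
  refine setIntegral_congr_fun measurableSet_Ioi fun t ht => ?_
  simp only [norm_mul, Complex.norm_real, Real.norm_of_nonneg (Real.exp_pos _).le,
    Complex.norm_cpow_eq_rpow_re_of_pos ht, Complex.sub_re, Complex.one_re]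

theorem continuousAt_Gamma_of_re_pos {s : ℂ} (hs : 0 < s.re) : ContinuousAt Complex.Gamma s := by
  refine (Complex.differentiableAt_Gamma s fun m h => ?_).continuousAt
  rw [h] at hs
  simp at hs
  exact absurd hs (not_lt.2 (Nat.cast_nonneg m))

/-- The kernel `Γ(a + ξ) Γ(-ξ)`, `ξ = σ + i y`, of the Mellin-Barnes representation of
`(1 + x)⁻ᵃ`. -/
def mellinBarnesKernel (a σ y : ℝ) : ℂ :=
  Complex.Gamma (a + (σ + y * Complex.I)) * Complex.Gamma (-(σ + y * Complex.I))

section kernel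

variable {a σ : ℝ}

theorem continuous_mellinBarnesKernel (h1 : -a < σ) (h2 : σ < 0) :
    Continuous (mellinBarnesKernel a σ) := by
  rw [continuous_iff_continuousAt]
  intro y
  refine ContinuousAt.mul ?_ ?_
  · refine ContinuousAt.comp (f := fun y : ℝ => (a + (σ + y * Complex.I) : ℂ))
      (continuousAt_Gamma_of_re_pos ?_) (by fun_prop)
    simp; linarith
  · refine ContinuousAt.comp (f := fun y : ℝ => (-(σ + y * Complex.I) : ℂ))
      (continuousAt_Gamma_of_re_pos ?_) (by fun_prop)
    simp; linarith

/-- Two steps of the recurrence, Γ(z) = Γ(z+2)/(z(z+1)), already give quadratic decay along the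
vertical line, so Stirling's formula is not needed: the remaining gamma values are bounded by those
at their real parts. -/
theorem norm_mellinBarnesKernel_le (h1 : -a < σ) (h2 : σ < 0) (y : ℝ) :
    ‖mellinBarnesKernel a σ y‖ ≤
      Real.Gamma (a + σ) * Real.Gamma (2 - σ) / min 1 (-σ) * (1 + y ^ 2)⁻¹ := by
  set z : ℂ := -(σ + y * Complex.I) with hz
  have hre : z.re = -σ := by simp [hz]
  have him : z.im = -y := by simp [hz]
  have hz0 : z ≠ 0 := fun h => by rw [h] at hre; simp at hre; linarith
  have hz1 : z + 1 ≠ 0 := fun h => by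
    have := congrArg Complex.re h
    simp [hre] at this; linarith
  have hG : Complex.Gamma z = Complex.Gamma (z + 2) / (z * (z + 1)) := by
    rw [show z + 2 = (z + 1) + 1 by ring, Complex.Gamma_add_one _ hz1, Complex.Gamma_add_one _ hz0]
    field_simp
  have hc : 0 < min 1 (-σ) := lt_min one_pos (by linarith)
  have hzn : ‖z‖ ^ 2 = σ ^ 2 + y ^ 2 := by
    rw [Complex.sq_norm, Complex.normSq_apply, hre, him]; ring
  have hzn1 : ‖z + 1‖ ^ 2 = (1 - σ) ^ 2 + y ^ 2 := by
    rw [Complex.sq_norm, Complex.normSq_apply, Complex.add_re, Complex.add_im, hre, him]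
    simp; ring
  have hlow : min 1 (-σ) * (1 + y ^ 2) ≤ ‖z‖ * ‖z + 1‖ := by
    refine abs_le_of_sq_le_sq' ?_ (by positivity) |>.2
    rw [mul_pow, mul_pow, hzn, hzn1]
    have e1 : min 1 (-σ) ^ 2 ≤ 1 := pow_le_one₀ hc.le (min_le_left _ _)
    have e2 : min 1 (-σ) ^ 2 ≤ σ ^ 2 := by
      rw [← neg_sq σ]; exact pow_le_pow_left₀ hc.le (min_le_right _ _) 2
    have e3 : min 1 (-σ) ^ 2 * (1 + y ^ 2) ≤ σ ^ 2 + y ^ 2 := by nlinarith [sq_nonneg y]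
    have e4 : 1 + y ^ 2 ≤ (1 - σ) ^ 2 + y ^ 2 := by nlinarith
    calc min 1 (-σ) ^ 2 * (1 + y ^ 2) ^ 2 = (min 1 (-σ) ^ 2 * (1 + y ^ 2)) * (1 + y ^ 2) := by ring
      _ ≤ _ := by gcongr
  have hA : ‖Complex.Gamma (a + (σ + y * Complex.I))‖ ≤ Real.Gamma (a + σ) := by
    have := norm_Gamma_le_Gamma_re (s := a + (σ + y * Complex.I)) (by simp; linarith)
    simpa using this
  have hB : ‖Complex.Gamma (z + 2)‖ ≤ Real.Gamma (2 - σ) := by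
    have e : (z + 2).re = 2 - σ := by rw [Complex.add_re, hre, Complex.re_ofNat]; ring
    exact e ▸ norm_Gamma_le_Gamma_re (s := z + 2) (by rw [e]; linarith)
  have hp1 : 0 ≤ Real.Gamma (a + σ) := Real.Gamma_nonneg_of_nonneg (by linarith)
  have hp2 : 0 ≤ Real.Gamma (2 - σ) := Real.Gamma_nonneg_of_nonneg (by linarith)
  rw [mellinBarnesKernel, ← hz, hG, norm_mul, norm_div, norm_mul]
  calc ‖Complex.Gamma (a + (σ + y * Complex.I))‖ * (‖Complex.Gamma (z + 2)‖ / (‖z‖ * ‖z + 1‖))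
      ≤ Real.Gamma (a + σ) * (Real.Gamma (2 - σ) / (min 1 (-σ) * (1 + y ^ 2))) := by
        gcongr
    _ = _ := by field_simp

theorem integrable_mellinBarnesKernel (h1 : -a < σ) (h2 : σ < 0) :
    Integrable (mellinBarnesKernel a σ) :=
  (integrable_inv_one_add_sq.const_mul _).mono'
    (continuous_mellinBarnesKernel h1 h2).aestronglyMeasurable
    (Eventually.of_forall (norm_mellinBarnesKernel_le h1 h2))

end kernel

/-- Justifies exchanging the integrals of x^(z-1) u^(a-1) e^(-(1+x)u): integrating over `u` first
produces the Mellin transform of (1+x)^(-a), over `x` first a product of gamma values. -/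
theorem integrable_mellin_beta {a : ℝ} {z : ℂ} (hz : 0 < z.re) (hza : z.re < a) :
    Integrable (fun p : ℝ × ℝ => (p.1 : ℂ) ^ (z - 1) *
        ((p.2 ^ (a - 1) * Real.exp (-((1 + p.1) * p.2)) : ℝ) : ℂ))
      ((volume.restrict (Set.Ioi 0)).prod (volume.restrict (Set.Ioi 0))) := by
  have hmeas : AEStronglyMeasurable (fun p : ℝ × ℝ => (p.1 : ℂ) ^ (z - 1) *
        ((p.2 ^ (a - 1) * Real.exp (-((1 + p.1) * p.2)) : ℝ) : ℂ))
      ((volume.restrict (Set.Ioi 0)).prod (volume.restrict (Set.Ioi 0))) := by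
    refine Measurable.aestronglyMeasurable ?_
    fun_prop
  have hnorm : ∀ x ∈ Set.Ioi (0 : ℝ), ∀ u ∈ Set.Ioi (0 : ℝ), ‖(x : ℂ) ^ (z - 1) *
        ((u ^ (a - 1) * Real.exp (-((1 + x) * u)) : ℝ) : ℂ)‖
        = (u ^ (a - 1) * Real.exp (-u)) * (x ^ (z.re - 1) * Real.exp (-(u * x))) := by
    intro x hx u hu
    have hu' : (0 : ℝ) < u := hu
    rw [norm_mul, Complex.norm_cpow_eq_rpow_re_of_pos hx, Complex.norm_real,
      Real.norm_of_nonneg (by positivity), Complex.sub_re, Complex.one_re,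
      show -((1 + x) * u) = -u + -(u * x) by ring, Real.exp_add]
    ring
  rw [integrable_prod_iff' hmeas]
  constructor
  · refine (ae_restrict_mem measurableSet_Ioi).mono fun u hu => ?_
    have hu' : (0 : ℝ) < u := hu
    have h0 : IntegrableOn (fun x : ℝ => (u ^ (a - 1) * Real.exp (-u)) *
        (x ^ (z.re - 1) * Real.exp (-(u * x)))) (Set.Ioi 0) := by
      have := integrableOn_rpow_mul_exp_neg_mul_rpow (p := 1) (s := z.re - 1) (b := u)
        (by linarith) one_pos hu'
      simp only [Real.rpow_one, neg_mul] at this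
      exact this.const_mul _
    refine h0.mono' (Measurable.aestronglyMeasurable (by fun_prop)) ?_
    exact (ae_restrict_mem measurableSet_Ioi).mono fun x hx => (hnorm x hx u hu).le
  · have hval : ∀ u ∈ Set.Ioi (0 : ℝ), Real.Gamma z.re * (Real.exp (-u) * u ^ ((a - z.re) - 1))
        = ∫ x in Set.Ioi (0 : ℝ), ‖(x : ℂ) ^ (z - 1) *
        ((u ^ (a - 1) * Real.exp (-((1 + x) * u)) : ℝ) : ℂ)‖ := by
      intro u hu
      have hu' : (0 : ℝ) < u := hu
      rw [setIntegral_congr_fun measurableSet_Ioi fun x hx => hnorm x hx u hu,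
        integral_const_mul, Real.integral_rpow_mul_exp_neg_mul_Ioi hz hu',
        show a - z.re - 1 = (a - 1) + -z.re by ring, Real.rpow_add hu', Real.rpow_neg hu'.le,
        one_div, Real.inv_rpow hu'.le]
      ring
    have h0 := (Real.GammaIntegral_convergent (s := a - z.re) (by linarith)).const_mul
      (Real.Gamma z.re)
    exact IntegrableOn.congr_fun h0 hval measurableSet_Ioi

theorem integral_rpow_mul_exp_ofReal {a r : ℝ} (ha : 0 < a) (hr : 0 < r) :
    ∫ u in Set.Ioi (0 : ℝ), ((u ^ (a - 1) * Real.exp (-(r * u)) : ℝ) : ℂ)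
      = (Real.Gamma a : ℂ) * (((1 / r) ^ a : ℝ) : ℂ) := by
  rw [integral_complex_ofReal, Real.integral_rpow_mul_exp_neg_mul_Ioi ha hr]
  push_cast
  ring

theorem mellinConvergent_one_add_rpow {a : ℝ} {z : ℂ} (hz : 0 < z.re) (hza : z.re < a) :
    MellinConvergent (fun x : ℝ => (((1 / (1 + x)) ^ a : ℝ) : ℂ)) z := by
  have ha : 0 < a := hz.trans hza
  have h := (integrable_mellin_beta hz hza).integral_prod_left
  have hG : (Real.Gamma a : ℂ) ≠ 0 := by exact_mod_cast (Real.Gamma_pos_of_pos ha).ne'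
  have h2 := h.const_mul (Real.Gamma a : ℂ)⁻¹
  refine IntegrableOn.congr_fun h2 (fun x hx => ?_) measurableSet_Ioi
  have hx' : (0 : ℝ) < x := hx
  simp only [smul_eq_mul]
  rw [integral_const_mul, integral_rpow_mul_exp_ofReal ha (by linarith)]
  field_simp

theorem Gamma_mul_mellin_one_add_rpow {a : ℝ} {z : ℂ} (hz : 0 < z.re) (hza : z.re < a) :
    (Real.Gamma a : ℂ) * mellin (fun x : ℝ => (((1 / (1 + x)) ^ a : ℝ) : ℂ)) z
      = Complex.Gamma (a - z) * Complex.Gamma z := by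
  have ha : 0 < a := hz.trans hza
  have hL : ∫ x in Set.Ioi (0 : ℝ), ∫ u in Set.Ioi (0 : ℝ), (x : ℂ) ^ (z - 1) *
        ((u ^ (a - 1) * Real.exp (-((1 + x) * u)) : ℝ) : ℂ)
      = (Real.Gamma a : ℂ) * mellin (fun x : ℝ => (((1 / (1 + x)) ^ a : ℝ) : ℂ)) z := by
    rw [mellin, ← integral_const_mul]
    refine setIntegral_congr_fun measurableSet_Ioi fun x hx => ?_
    have hx' : (0 : ℝ) < x := hx
    simp only [smul_eq_mul]
    rw [integral_const_mul, integral_rpow_mul_exp_ofReal ha (by linarith)]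
    ring
  have hR : ∫ u in Set.Ioi (0 : ℝ), ∫ x in Set.Ioi (0 : ℝ), (x : ℂ) ^ (z - 1) *
        ((u ^ (a - 1) * Real.exp (-((1 + x) * u)) : ℝ) : ℂ)
      = Complex.Gamma (a - z) * Complex.Gamma z := by
    rw [Complex.Gamma_eq_integral (s := a - z) (by simpa using hza), Complex.GammaIntegral,
      ← integral_mul_const]
    refine setIntegral_congr_fun measurableSet_Ioi fun u hu => ?_
    have hu' : (0 : ℝ) < u := hu
    have huc : (u : ℂ) ≠ 0 := by exact_mod_cast hu'.ne'
    have : ∀ x : ℝ, (x : ℂ) ^ (z - 1) * ((u ^ (a - 1) * Real.exp (-((1 + x) * u)) : ℝ) : ℂ)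
        = ((u ^ (a - 1) * Real.exp (-u) : ℝ) : ℂ)
          * ((x : ℂ) ^ (z - 1) * Complex.exp (-(u * x))) := by
      intro x
      rw [show -((1 + x) * u) = -u + -(u * x) by ring, Real.exp_add]
      push_cast
      ring
    simp_rw [this]
    rw [integral_const_mul, Complex.integral_cpow_mul_exp_neg_mul_Ioi hz hu',
      show (a : ℂ) - z - 1 = ((a - 1 : ℝ) : ℂ) + -z by push_cast; ring, Complex.cpow_add _ _ huc,
      one_div, Complex.inv_cpow _ _ (by rw [Complex.arg_ofReal_of_nonneg hu'.le]; exact Real.pi_pos.ne),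
      Complex.cpow_neg, Complex.ofReal_mul, Complex.ofReal_cpow hu'.le]
    ring
  rw [← hL, ← hR]
  exact integral_integral_swap (integrable_mellin_beta hz hza)

/-- The Mellin-Barnes representation of `(1 + x)⁻ᵃ`. -/
theorem integral_mellinBarnesKernel_mul_cpow {a σ x : ℝ} (h1 : -a < σ) (h2 : σ < 0) (hx : 0 < x) :
    ∫ y : ℝ, mellinBarnesKernel a σ y * (x : ℂ) ^ (σ + y * Complex.I : ℂ)
      = ((2 * Real.pi * (Real.Gamma a * (1 / (1 + x)) ^ a) : ℝ) : ℂ) := by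
  have ha : 0 < a := by linarith
  set f : ℝ → ℂ := fun x => (((1 / (1 + x)) ^ a : ℝ) : ℂ) with hf
  have hre : ∀ y : ℝ, (((-σ : ℝ) : ℂ) + y * Complex.I).re = -σ := fun y => by simp
  have hG : (Real.Gamma a : ℂ) ≠ 0 := by exact_mod_cast (Real.Gamma_pos_of_pos ha).ne'
  -- Mellin inversion uses x^(-z) while the contour integral uses x^ξ, so ξ = -z: the abscissa is
  -- `-σ` and the ordinate changes sign.
  have hmel : ∀ y : ℝ, mellin f (((-σ : ℝ) : ℂ) + y * Complex.I)
      = (Real.Gamma a : ℂ)⁻¹ * mellinBarnesKernel a σ (-y) := by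
    intro y
    have := Gamma_mul_mellin_one_add_rpow (a := a) (z := ((-σ : ℝ) : ℂ) + y * Complex.I)
      (by rw [hre]; linarith) (by rw [hre]; linarith)
    rw [eq_inv_mul_iff_mul_eq₀ hG, this, mellinBarnesKernel]
    congr 2 <;> (push_cast; ring)
  have hvert : Complex.VerticalIntegrable (mellin f) (-σ) := by
    unfold Complex.VerticalIntegrable
    simp_rw [hmel]
    exact ((integrable_mellinBarnesKernel h1 h2).comp_neg).const_mul _
  have hconv : MellinConvergent f ((-σ : ℝ) : ℂ) :=
    mellinConvergent_one_add_rpow (by simpa using h2) (by simp; linarith)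
  have hcont : ContinuousAt f x := by
    refine Complex.continuous_ofReal.continuousAt.comp ?_
    refine ContinuousAt.rpow_const ?_ (Or.inl (by positivity))
    exact continuousAt_const.div (by fun_prop) (by positivity)
  have hinv := mellinInv_mellin_eq (-σ) f hx hconv hvert hcont
  rw [mellinInv] at hinv
  have hint : ∫ y : ℝ, (x : ℂ) ^ (-(((-σ : ℝ) : ℂ) + y * Complex.I)) •
        mellin f (((-σ : ℝ) : ℂ) + y * Complex.I)
      = (Real.Gamma a : ℂ)⁻¹ *
        ∫ y : ℝ, mellinBarnesKernel a σ y * (x : ℂ) ^ (σ + y * Complex.I : ℂ) := by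
    rw [← integral_const_mul, ← integral_neg_eq_self]
    refine integral_congr_ae (Eventually.of_forall fun y => ?_)
    simp only [smul_eq_mul]
    rw [hmel, neg_neg, show -(((-σ : ℝ) : ℂ) + ((-y : ℝ) : ℂ) * Complex.I) = σ + y * Complex.I by
      push_cast; ring]
    ring
  rw [hint] at hinv
  have hpi : (Real.pi : ℂ) ≠ 0 := by exact_mod_cast Real.pi_ne_zero
  have hinv' : (1 / (2 * Real.pi : ℂ)) * ((Real.Gamma a : ℂ)⁻¹ *
        ∫ y : ℝ, mellinBarnesKernel a σ y * (x : ℂ) ^ (σ + y * Complex.I : ℂ))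
        = (((1 / (1 + x)) ^ a : ℝ) : ℂ) := by
    rw [← show f x = (((1 / (1 + x)) ^ a : ℝ) : ℂ) from rfl, ← hinv]
    simp [Complex.real_smul]
  rw [Complex.ofReal_mul, Complex.ofReal_mul, Complex.ofReal_mul, ← hinv']
  generalize ∫ y : ℝ, mellinBarnesKernel a σ y * (x : ℂ) ^ (σ + y * Complex.I : ℂ) = J
  push_cast
  field_simp

/-! ### The two-variable Meijer G-function as a real integral -/

section meijer

variable {σ τ a c c' x y : ℝ}

theorem meijerG2OnContour_eq (p : ℝ × ℝ) :
    meijerG2OnContour σ τ a c c' 0 0 x y p =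
      Complex.Gamma (a + (σ + p.1 * Complex.I) + (τ + p.2 * Complex.I)) *
        ((mellinBarnesKernel (1 - c) σ p.1 * (x : ℂ) ^ (σ + p.1 * Complex.I : ℂ)) *
        (mellinBarnesKernel (1 - c') τ p.2 * (y : ℂ) ^ (τ + p.2 * Complex.I : ℂ))) := by
  simp only [meijerG2OnContour, meijerG2Integrand, mellinBarnesKernel, Complex.ofReal_zero,
    zero_sub, Complex.ofReal_sub, Complex.ofReal_one]
  ring

theorem integrable_mellinBarnesKernel_mul_cpow {a : ℝ} (h1 : -a < σ) (h2 : σ < 0) (hx : 0 < x) :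
    Integrable fun s : ℝ => mellinBarnesKernel a σ s * (x : ℂ) ^ (σ + s * Complex.I : ℂ) := by
  refine ((integrable_mellinBarnesKernel h1 h2).norm.mul_const (x ^ σ)).mono' ?_ ?_
  · refine ((continuous_mellinBarnesKernel h1 h2).mul ?_).aestronglyMeasurable
    exact Continuous.const_cpow (by fun_prop) (Or.inl (by exact_mod_cast hx.ne'))
  · refine Eventually.of_forall fun s => ?_
    rw [norm_mul, Complex.norm_cpow_eq_rpow_re_of_pos hx]
    simp

/-- The Mellin-Barnes integrand with `Γ(a + ξ + η)` expanded as Euler's integral is absolutely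
integrable. -/
theorem integrable_meijerG2_euler (hc : IsMeijerG2Contour a c c' 0 0 σ τ) (hx : 0 < x)
    (hy : 0 < y) :
    Integrable (fun q : (ℝ × ℝ) × ℝ =>
      (((mellinBarnesKernel (1 - c) σ q.1.1 * (x : ℂ) ^ (σ + q.1.1 * Complex.I : ℂ)) *
        (mellinBarnesKernel (1 - c') τ q.1.2 * (y : ℂ) ^ (τ + q.1.2 * Complex.I : ℂ)))) *
        (((Real.exp (-q.2) : ℝ) : ℂ) *
          (q.2 : ℂ) ^ (a + (σ + q.1.1 * Complex.I) + (τ + q.1.2 * Complex.I) - 1 : ℂ)))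
      ((volume : Measure (ℝ × ℝ)).prod (volume.restrict (Set.Ioi 0))) := by
  obtain ⟨h1, h2, h3, h4, h5⟩ := hc
  have k1 : Integrable fun s : ℝ => mellinBarnesKernel (1 - c) σ s * (x : ℂ) ^ (σ + s * Complex.I : ℂ) :=
    integrable_mellinBarnesKernel_mul_cpow (by linarith) h2 hx
  have k2 : Integrable fun s : ℝ => mellinBarnesKernel (1 - c') τ s * (y : ℂ) ^ (τ + s * Complex.I : ℂ) :=
    integrable_mellinBarnesKernel_mul_cpow (by linarith) h4 hy
  have k12 := k1.mul_prod k2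
  have k3 := k12.norm.mul_prod (Real.GammaIntegral_convergent h5)
  refine k3.mono' ?_ ?_
  · refine AEStronglyMeasurable.mul ?_ ?_
    · exact k12.1.comp_fst
    · refine Measurable.aestronglyMeasurable ?_
      fun_prop
  · have hae : ∀ᵐ q : (ℝ × ℝ) × ℝ ∂((volume : Measure (ℝ × ℝ)).prod (volume.restrict (Set.Ioi 0))),
        q.2 ∈ Set.Ioi (0 : ℝ) :=
      Measure.quasiMeasurePreserving_snd.ae (ae_restrict_mem measurableSet_Ioi)
    refine hae.mono fun q hq => ?_
    rw [norm_mul]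
    refine le_of_eq ?_
    congr 1
    rw [norm_mul, Complex.norm_cpow_eq_rpow_re_of_pos hq, Complex.norm_real,
      Real.norm_of_nonneg (Real.exp_pos _).le]
    simp

theorem Gamma_eq_integral_of_contour (hc : IsMeijerG2Contour a c c' 0 0 σ τ) (p : ℝ × ℝ) :
    Complex.Gamma (a + (σ + p.1 * Complex.I) + (τ + p.2 * Complex.I))
      = ∫ t in Set.Ioi (0 : ℝ), ((Real.exp (-t) : ℝ) : ℂ) *
          (t : ℂ) ^ (a + (σ + p.1 * Complex.I) + (τ + p.2 * Complex.I) - 1 : ℂ) := by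
  rw [Complex.Gamma_eq_integral (by simpa using hc.2.2.2.2), Complex.GammaIntegral]

theorem integrable_meijerG2OnContour (hc : IsMeijerG2Contour a c c' 0 0 σ τ) (hx : 0 < x)
    (hy : 0 < y) : Integrable (meijerG2OnContour σ τ a c c' 0 0 x y) := by
  refine (integrable_meijerG2_euler hc hx hy).integral_prod_left.congr
    (Eventually.of_forall fun p => ?_)
  simp only
  rw [meijerG2OnContour_eq, integral_const_mul, ← Gamma_eq_integral_of_contour hc, mul_comm]

/-- After Euler's integral for Γ(a+ξ+η), the factor t^(ξ+η) is absorbed into (xt)^ξ (yt)^η. For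
fixed `t` the double contour integral is then a product of two Mellin-Barnes integrals, and their
factors 2π cancel (2πi)⁻² together with i². -/
theorem meijerG2_eq_integral (hc : IsMeijerG2Contour a c c' 0 0 σ τ) (hx : 0 < x) (hy : 0 < y) :
    meijerG2 σ τ a c c' 0 0 x y =
      ((Real.Gamma (1 - c) * Real.Gamma (1 - c') *
        ∫ t in Set.Ioi (0 : ℝ), t ^ (a - 1) * Real.exp (-t) *
          (1 / (1 + x * t)) ^ (1 - c) * (1 / (1 + y * t)) ^ (1 - c') : ℝ) : ℂ) := by
  have hL : ∫ p : ℝ × ℝ, ∫ t in Set.Ioi (0 : ℝ),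
      (((mellinBarnesKernel (1 - c) σ p.1 * (x : ℂ) ^ (σ + p.1 * Complex.I : ℂ)) *
        (mellinBarnesKernel (1 - c') τ p.2 * (y : ℂ) ^ (τ + p.2 * Complex.I : ℂ)))) *
        (((Real.exp (-t) : ℝ) : ℂ) *
          (t : ℂ) ^ (a + (σ + p.1 * Complex.I) + (τ + p.2 * Complex.I) - 1 : ℂ))
      = ∫ p : ℝ × ℝ, meijerG2OnContour σ τ a c c' 0 0 x y p := by
    refine integral_congr_ae (Eventually.of_forall fun p => ?_)
    simp only
    rw [meijerG2OnContour_eq, integral_const_mul, ← Gamma_eq_integral_of_contour hc, mul_comm]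
  have hR : ∫ t in Set.Ioi (0 : ℝ), ∫ p : ℝ × ℝ,
      (((mellinBarnesKernel (1 - c) σ p.1 * (x : ℂ) ^ (σ + p.1 * Complex.I : ℂ)) *
        (mellinBarnesKernel (1 - c') τ p.2 * (y : ℂ) ^ (τ + p.2 * Complex.I : ℂ)))) *
        (((Real.exp (-t) : ℝ) : ℂ) *
          (t : ℂ) ^ (a + (σ + p.1 * Complex.I) + (τ + p.2 * Complex.I) - 1 : ℂ))
      = (((2 * Real.pi) ^ 2 * (Real.Gamma (1 - c) * Real.Gamma (1 - c') *
        ∫ t in Set.Ioi (0 : ℝ), t ^ (a - 1) * Real.exp (-t) *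
          (1 / (1 + x * t)) ^ (1 - c) * (1 / (1 + y * t)) ^ (1 - c')) : ℝ) : ℂ) := by
    rw [← mul_assoc, ← integral_const_mul, ← integral_complex_ofReal]
    refine setIntegral_congr_fun measurableSet_Ioi fun t ht => ?_
    have ht' : (0 : ℝ) < t := ht
    have htc : (t : ℂ) ≠ 0 := by exact_mod_cast ht'.ne'
    obtain ⟨h1, h2, h3, h4, h5⟩ := hc
    have e1 := integral_mellinBarnesKernel_mul_cpow (a := 1 - c) (σ := σ) (x := x * t)
      (by linarith) h2 (by positivity)
    have e2 := integral_mellinBarnesKernel_mul_cpow (a := 1 - c') (σ := τ) (x := y * t)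
      (by linarith) h4 (by positivity)
    have e3 := integral_prod_mul (μ := (volume : Measure ℝ)) (ν := (volume : Measure ℝ))
      (fun s : ℝ => mellinBarnesKernel (1 - c) σ s * ((x * t : ℝ) : ℂ) ^ (σ + s * Complex.I : ℂ))
      (fun s : ℝ => mellinBarnesKernel (1 - c') τ s * ((y * t : ℝ) : ℂ) ^ (τ + s * Complex.I : ℂ))
    rw [e1, e2] at e3
    have e4 : ∀ p : ℝ × ℝ,
      (((mellinBarnesKernel (1 - c) σ p.1 * (x : ℂ) ^ (σ + p.1 * Complex.I : ℂ)) *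
        (mellinBarnesKernel (1 - c') τ p.2 * (y : ℂ) ^ (τ + p.2 * Complex.I : ℂ)))) *
        (((Real.exp (-t) : ℝ) : ℂ) *
          (t : ℂ) ^ (a + (σ + p.1 * Complex.I) + (τ + p.2 * Complex.I) - 1 : ℂ))
        = ((t ^ (a - 1) * Real.exp (-t) : ℝ) : ℂ) *
        ((mellinBarnesKernel (1 - c) σ p.1 * ((x * t : ℝ) : ℂ) ^ (σ + p.1 * Complex.I : ℂ)) *
        (mellinBarnesKernel (1 - c') τ p.2 * ((y * t : ℝ) : ℂ) ^ (τ + p.2 * Complex.I : ℂ))) := by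
      intro p
      rw [Complex.ofReal_mul x t, Complex.ofReal_mul y t,
        Complex.mul_cpow_ofReal_nonneg hx.le ht'.le, Complex.mul_cpow_ofReal_nonneg hy.le ht'.le,
        show (a + (σ + p.1 * Complex.I) + (τ + p.2 * Complex.I) - 1 : ℂ)
          = ((a - 1 : ℝ) : ℂ) + (σ + p.1 * Complex.I) + (τ + p.2 * Complex.I) by push_cast; ring,
        Complex.cpow_add _ _ htc, Complex.cpow_add _ _ htc, Complex.ofReal_mul (t ^ (a - 1)),
        Complex.ofReal_cpow ht'.le]
      ring
    simp only [e4]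
    rw [integral_const_mul]
    change _ * ∫ p, _ ∂(volume.prod volume) = _
    rw [e3]
    push_cast
    ring
  have hint := hL.symm.trans (Eq.trans
    (integral_integral_swap (by exact integrable_meijerG2_euler hc hx hy)) hR)
  rw [meijerG2, integral_mul_const, hint]
  generalize (∫ t in Set.Ioi (0 : ℝ), t ^ (a - 1) * Real.exp (-t) *
          (1 / (1 + x * t)) ^ (1 - c) * (1 / (1 + y * t)) ^ (1 - c')) = J
  have hpi : (Real.pi : ℂ) ≠ 0 := by exact_mod_cast Real.pi_ne_zero
  have hI : Complex.I ^ 2 = -1 := Complex.I_sq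
  rw [Complex.ofReal_mul]
  push_cast
  rw [one_div, inv_pow, mul_pow, hI]
  field_simp

end meijer

/-! ### The zero-forcing projection and the resulting SINR -/

section projection

variable {N M : ℕ} {H : Matrix (Fin N) (Fin M) ℂ}

theorem zfProjection_isHermitian (H : Matrix (Fin N) (Fin M) ℂ) : (zfProjection H).IsHermitian := by
  unfold zfProjection
  have hG : (H.conjTranspose * H)⁻¹.IsHermitian :=
    (Matrix.isHermitian_conjTranspose_mul_self H).inv
  refine Matrix.isHermitian_one.sub ?_
  unfold Matrix.IsHermitian
  rw [Matrix.conjTranspose_mul, Matrix.conjTranspose_mul, hG.eq, Matrix.conjTranspose_conjTranspose,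
    Matrix.mul_assoc]

theorem zfProjection_mul_self (hdet : (H.conjTranspose * H).det ≠ 0) :
    zfProjection H * H = 0 := by
  unfold zfProjection
  rw [Matrix.sub_mul, Matrix.one_mul, Matrix.mul_assoc, Matrix.mul_assoc,
    Matrix.nonsing_inv_mul _ (isUnit_iff_ne_zero.2 hdet), Matrix.mul_one, sub_self]

theorem zfProjection_idempotent (hdet : (H.conjTranspose * H).det ≠ 0) :
    zfProjection H * zfProjection H = zfProjection H := by
  conv_lhs =>
    enter [2]
    unfold zfProjection
  rw [Matrix.mul_sub, Matrix.mul_one, ← Matrix.mul_assoc, ← Matrix.mul_assoc,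
    zfProjection_mul_self hdet, Matrix.zero_mul, Matrix.zero_mul, sub_zero]

theorem dotProduct_star_self_eq_normSqF (v : Fin N → ℂ) : star v ⬝ᵥ v = (normSqF v : ℂ) := by
  simp [dotProduct, normSqF, Complex.conj_mul']

theorem dotProduct_self_star_eq_normSqF (v : Fin N → ℂ) : v ⬝ᵥ star v = (normSqF v : ℂ) := by
  rw [dotProduct_comm, dotProduct_star_self_eq_normSqF]

theorem normSqF_nonneg (v : Fin N → ℂ) : 0 ≤ normSqF v :=
  Finset.sum_nonneg fun _ _ => by positivity

theorem normSqF_smul (c : ℂ) (v : Fin N → ℂ) : normSqF (c • v) = ‖c‖ ^ 2 * normSqF v := by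
  simp [normSqF, mul_pow, Finset.mul_sum]

/-- The channel gain `h† P h` of the zero-forcing combiner. -/
def zfGain (h : Fin N → ℂ) (H : Matrix (Fin N) (Fin M) ℂ) : ℝ :=
  (star h ⬝ᵥ (zfProjection H).mulVec h).re

theorem star_dotProduct_zfProjection_mulVec (hdet : (H.conjTranspose * H).det ≠ 0)
    (h : Fin N → ℂ) :
    star h ⬝ᵥ (zfProjection H).mulVec h = (normSqF ((zfProjection H).vecMul (star h)) : ℂ) := by
  rw [← dotProduct_self_star_eq_normSqF, Matrix.star_vecMul, star_star,
    (zfProjection_isHermitian H).eq, ← Matrix.dotProduct_mulVec, Matrix.mulVec_mulVec,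
    zfProjection_idempotent hdet]

theorem zfGain_eq_normSqF (hdet : (H.conjTranspose * H).det ≠ 0) (h : Fin N → ℂ) :
    zfGain h H = normSqF ((zfProjection H).vecMul (star h)) := by
  rw [zfGain, star_dotProduct_zfProjection_mulVec hdet, Complex.ofReal_re]

theorem zfGain_nonneg (hdet : (H.conjTranspose * H).det ≠ 0) (h : Fin N → ℂ) : 0 ≤ zfGain h H := by
  rw [zfGain_eq_normSqF hdet]
  exact normSqF_nonneg _

theorem zfCombiner_dotProduct (hdet : (H.conjTranspose * H).det ≠ 0) (h : Fin N → ℂ) :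
    zfCombiner h H ⬝ᵥ h = (Real.sqrt (zfGain h H) : ℂ) := by
  rw [zfCombiner, smul_dotProduct, ← Matrix.dotProduct_mulVec,
    star_dotProduct_zfProjection_mulVec hdet, ← zfGain_eq_normSqF hdet, smul_eq_mul,
    Complex.ofReal_re]
  norm_cast
  rw [inv_mul_eq_div, Real.div_sqrt]

theorem zfCombiner_dotProduct_col (hdet : (H.conjTranspose * H).det ≠ 0) (h : Fin N → ℂ)
    (i : Fin M) : zfCombiner h H ⬝ᵥ (fun n => H n i) = 0 := by
  have h0 : (zfProjection H).mulVec (fun n => H n i) = 0 := by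
    funext m
    exact congrFun (congrFun (zfProjection_mul_self hdet) m) i
  rw [zfCombiner, smul_dotProduct, ← Matrix.dotProduct_mulVec, h0, dotProduct_zero, smul_zero]

theorem normSqF_zfCombiner (hdet : (H.conjTranspose * H).det ≠ 0) (h : Fin N → ℂ)
    (hX : zfGain h H ≠ 0) : normSqF (zfCombiner h H) = 1 := by
  rw [zfCombiner, normSqF_smul, ← zfGain_eq_normSqF hdet,
    show (star h ⬝ᵥ (zfProjection H).mulVec h).re = zfGain h H from rfl, norm_inv, Complex.norm_real,
    Real.norm_of_nonneg (Real.sqrt_nonneg _), inv_pow, Real.sq_sqrt (zfGain_nonneg hdet h),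
    inv_mul_cancel₀ hX]

theorem star_dotProduct_normalize (h₂ : Fin N → ℂ) :
    star h₂ ⬝ᵥ ((Real.sqrt (normSqF h₂) : ℂ)⁻¹ • h₂) = (Real.sqrt (normSqF h₂) : ℂ) := by
  rw [dotProduct_smul, dotProduct_star_self_eq_normSqF, smul_eq_mul]
  norm_cast
  rw [inv_mul_eq_div, Real.div_sqrt]

theorem star_dotProduct_zfRelayMatrix_mulVec (ρ₁ ρ₂ : ℝ) (h₁ h₂ v : Fin N → ℂ)
    (H : Matrix (Fin N) (Fin M) ℂ) :
    star h₂ ⬝ᵥ (zfRelayMatrix ρ₁ ρ₂ h₁ H h₂).mulVec v =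
      (Real.sqrt (zfPowerFactorSq ρ₁ ρ₂ h₁ H) : ℂ) *
        ((Real.sqrt (normSqF h₂) : ℂ) * (zfCombiner h₁ H ⬝ᵥ v)) := by
  rw [zfRelayMatrix, Matrix.smul_mulVec, dotProduct_smul, Matrix.vecMulVec_mulVec, smul_eq_mul]
  rw [dotProduct_smul, star_dotProduct_normalize, MulOpposite.smul_eq_mul_unop,
    MulOpposite.unop_op]

theorem vecMul_zfRelayMatrix (ρ₁ ρ₂ : ℝ) (h₁ h₂ : Fin N → ℂ)
    (H : Matrix (Fin N) (Fin M) ℂ) :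
    (zfRelayMatrix ρ₁ ρ₂ h₁ H h₂).vecMul (star h₂) =
      ((Real.sqrt (zfPowerFactorSq ρ₁ ρ₂ h₁ H) : ℂ) * (Real.sqrt (normSqF h₂) : ℂ)) •
        zfCombiner h₁ H := by
  rw [zfRelayMatrix, Matrix.vecMul_smul, Matrix.vecMul_vecMulVec, star_dotProduct_normalize,
    smul_smul]

/-- With `a = ρ₁ h₁† P h₁` and `b = ρ₂ ‖h₂‖²`, the SINR of the ZF/MRT scheme is
`a b / (1 + a + b)`. -/
theorem zfSINR_eq (hdet : (H.conjTranspose * H).det ≠ 0) {P Pr N₀ : ℝ} (hP : 0 < P) (hPr : 0 < Pr)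
    (hN₀ : 0 < N₀) (PI : Fin M → ℝ) (h₁ h₂ : Fin N → ℂ) :
    zfSINR P Pr N₀ PI h₁ H h₂ =
      (P / N₀ * zfGain h₁ H) * (Pr / N₀ * normSqF h₂) /
        (1 + P / N₀ * zfGain h₁ H + Pr / N₀ * normSqF h₂) := by
  have hX := zfGain_nonneg hdet h₁
  have hY := normSqF_nonneg h₂
  have hw : ‖zfCombiner h₁ H ⬝ᵥ h₁‖ ^ 2 = zfGain h₁ H := by
    rw [zfCombiner_dotProduct hdet, Complex.norm_real, Real.norm_of_nonneg (Real.sqrt_nonneg _),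
      Real.sq_sqrt hX]
  have hω : zfPowerFactorSq (P / N₀) (Pr / N₀) h₁ H = (Pr / N₀) / (zfGain h₁ H * (P / N₀) + 1) := by
    rw [zfPowerFactorSq, hw]
  have hω0 : 0 ≤ zfPowerFactorSq (P / N₀) (Pr / N₀) h₁ H := by rw [hω]; positivity
  unfold zfSINR endToEndSINR
  simp only [star_dotProduct_zfRelayMatrix_mulVec, vecMul_zfRelayMatrix,
    zfCombiner_dotProduct_col hdet, normSqF_smul, norm_mul, mul_pow, hw, Complex.norm_real,
    Real.norm_of_nonneg (Real.sqrt_nonneg _), Real.sq_sqrt hω0, Real.sq_sqrt hY, mul_zero,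
    norm_zero, zero_mul, Finset.sum_const_zero, ne_eq, OfNat.ofNat_ne_zero, not_false_eq_true,
    zero_pow, zero_add]
  -- With zero gain the combiner is not a unit vector, but both numerators vanish.
  by_cases h0 : zfGain h₁ H = 0
  · simp [h0]
  · rw [normSqF_zfCombiner hdet h₁ h0, hω]
    field_simp
    ring

end projection

/-! ### Determinant and positivity of `1 + sP` -/

section rank

variable {N M : ℕ} {H : Matrix (Fin N) (Fin M) ℂ}

/-- Factor out 1+s and apply Sylvester's identity: the N × N determinant becomes that of (1 -
s/(1+s)) times the M × M identity, which gives (1+s)^N (1+s)^(-M). -/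
theorem det_one_add_smul_zfProjection (hMN : M ≤ N) (hdet : (H.conjTranspose * H).det ≠ 0) {s : ℝ}
    (hs : 0 ≤ s) :
    (1 + (s : ℂ) • zfProjection H).det = (((1 + s) ^ (N - M) : ℝ) : ℂ) := by
  have hs1 : (1 + s : ℂ) ≠ 0 := by
    have : (1 + s : ℝ) ≠ 0 := by positivity
    exact_mod_cast this
  have e1 : 1 + (s : ℂ) • zfProjection H = (1 + s : ℂ) •
      (1 - ((s / (1 + s) : ℂ) • H) * ((H.conjTranspose * H)⁻¹ * H.conjTranspose)) := by
    rw [zfProjection, smul_sub, smul_sub, Matrix.smul_mul, smul_smul, add_smul, one_smul,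
      mul_div_cancel₀ _ hs1, Matrix.mul_assoc, add_sub_assoc]
  have e2 : ((H.conjTranspose * H)⁻¹ * H.conjTranspose) * ((s / (1 + s) : ℂ) • H)
      = (s / (1 + s) : ℂ) • 1 := by
    rw [Matrix.mul_smul, Matrix.mul_assoc, Matrix.nonsing_inv_mul _ (isUnit_iff_ne_zero.2 hdet)]
  have e3 : (1 : Matrix (Fin M) (Fin M) ℂ) - (s / (1 + s) : ℂ) • 1 = (1 + s : ℂ)⁻¹ • 1 := by
    conv_lhs => rw [← one_smul ℂ (1 : Matrix (Fin M) (Fin M) ℂ), smul_smul, mul_one, ← sub_smul]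
    congr 1
    field_simp
    ring
  rw [e1, Matrix.det_smul, Matrix.det_one_sub_mul_comm, e2, e3, Matrix.det_smul, Matrix.det_one,
    Fintype.card_fin, Fintype.card_fin, mul_one, inv_pow,
    ← pow_sub₀ _ hs1 hMN]
  push_cast
  rfl

open scoped ComplexOrder in
theorem posDef_one_add_smul_zfProjection (hdet : (H.conjTranspose * H).det ≠ 0) {s : ℝ}
    (hs : 0 ≤ s) : (1 + (s : ℂ) • zfProjection H).PosDef := by
  have hP : (zfProjection H).PosSemidef := by
    have := Matrix.posSemidef_conjTranspose_mul_self (zfProjection H)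
    rwa [(zfProjection_isHermitian H).eq, zfProjection_idempotent hdet] at this
  exact Matrix.PosDef.one.add_posSemidef (hP.smul (by exact_mod_cast hs))

end rank

/-! ### Tonelli and densities for finite product measures -/

section pi

open scoped ENNReal

theorem lintegral_fin_prod_eq_prod {n : ℕ} {E : Fin n → Type*} {mE : ∀ i, MeasurableSpace (E i)}
    {μ : (i : Fin n) → Measure (E i)} [∀ i, SigmaFinite (μ i)] {f : (i : Fin n) → E i → ℝ≥0∞}
    (hf : ∀ i, Measurable (f i)) :
    ∫⁻ x : (i : Fin n) → E i, ∏ i, f i (x i) ∂(Measure.pi μ) = ∏ i, ∫⁻ x, f i x ∂(μ i) := by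
  induction n with
  | zero => simp
  | succ n ih =>
    have hm : Measurable fun x : (i : Fin n) → E (Fin.succ i) => ∏ i, f (Fin.succ i) (x i) :=
      Finset.measurable_prod _ fun i _ => (hf _).comp (measurable_pi_apply i)
    rw [Fin.prod_univ_succ, ← ih fun i => hf _, ← lintegral_prod_mul (hf 0).aemeasurable
      hm.aemeasurable]
    refine ((measurePreserving_piFinSuccAbove μ 0).symm.lintegral_comp_emb
      (MeasurableEquiv.measurableEmbedding _) (fun x => ∏ i, f i (x i))).symm.trans
      (lintegral_congr fun p => ?_)
    rw [Fin.prod_univ_succ]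
    rfl

variable {ι : Type*} [Fintype ι] {E : ι → Type*} {mE : ∀ i, MeasurableSpace (E i)}
  {μ : (i : ι) → Measure (E i)} [∀ i, SigmaFinite (μ i)] {f : (i : ι) → E i → ℝ≥0∞}

/-- Tonelli's theorem for a product of functions of one coordinate each. -/
theorem lintegral_fintype_prod_eq_prod (hf : ∀ i, Measurable (f i)) :
    ∫⁻ x : (i : ι) → E i, ∏ i, f i (x i) ∂(Measure.pi μ) = ∏ i, ∫⁻ x, f i x ∂(μ i) := by
  let e := (Fintype.equivFin ι).symm
  rw [← (measurePreserving_piCongrLeft _ e).lintegral_comp_emb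
    (MeasurableEquiv.measurableEmbedding _)]
  simp_rw [← e.prod_comp, MeasurableEquiv.coe_piCongrLeft, Equiv.piCongrLeft_apply_apply]
  exact lintegral_fin_prod_eq_prod fun i => hf _

/-- A product of measures with densities has the product density. -/
theorem pi_withDensity (hf : ∀ i, Measurable (f i)) [∀ i, SigmaFinite ((μ i).withDensity (f i))] :
    Measure.pi (fun i => (μ i).withDensity (f i)) =
      (Measure.pi μ).withDensity fun x => ∏ i, f i (x i) := by
  classical
  refine Measure.pi_eq fun s hs => ?_
  rw [withDensity_apply _ (MeasurableSet.univ_pi hs), ← lintegral_indicator (MeasurableSet.univ_pi hs)]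
  have h : ∀ x : (i : ι) → E i, (Set.univ.pi s).indicator (fun x => ∏ i, f i (x i)) x
      = ∏ i, (s i).indicator (f i) (x i) := by
    intro x
    by_cases hx : x ∈ Set.univ.pi s
    · rw [Set.indicator_of_mem hx]
      exact Finset.prod_congr rfl fun i _ => (Set.indicator_of_mem (hx i trivial) _).symm
    · rw [Set.indicator_of_notMem hx]
      simp only [Set.mem_pi, Set.mem_univ, true_imp_iff, not_forall] at hx
      obtain ⟨i, hi⟩ := hx
      exact (Finset.prod_eq_zero (Finset.mem_univ i) (Set.indicator_of_notMem hi _)).symm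
  simp_rw [h]
  rw [lintegral_fintype_prod_eq_prod fun i => (hf i).indicator (hs i)]
  exact Finset.prod_congr rfl fun i _ => by
    rw [lintegral_indicator (hs i), withDensity_apply _ (hs i)]

end pi

/-! ### Complex Gaussian vectors -/

section gaussian

/-- The density of `CN(0,1)`. -/
def complexNormalPDF (z : ℂ) : ENNReal := ENNReal.ofReal (Real.pi⁻¹ * Real.exp (-‖z‖ ^ 2))

theorem measurable_complexNormalPDF : Measurable complexNormalPDF := by
  unfold complexNormalPDF
  fun_prop

theorem complexNormal_eq_withDensity : complexNormal = volume.withDensity complexNormalPDF := by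
  have hv : (1 / 2 : NNReal) ≠ 0 := by norm_num
  have hmap := (Complex.volume_preserving_equiv_real_prod.symm)
  have hfun : (fun p : ℝ × ℝ => (p.1 : ℂ) + (p.2 : ℂ) * Complex.I)
      = Complex.measurableEquivRealProd.symm := by
    funext p
    apply Complex.ext <;> simp
  have hdens : ∀ p : ℝ × ℝ, gaussianPDF 0 (1 / 2) p.1 * gaussianPDF 0 (1 / 2) p.2
      = complexNormalPDF (Complex.measurableEquivRealProd.symm p) := by
    intro p
    rw [gaussianPDF, gaussianPDF, complexNormalPDF, ← ENNReal.ofReal_mul (gaussianPDFReal_nonneg _ _ _),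
      gaussianPDFReal, gaussianPDFReal, Complex.sq_norm, Complex.normSq_apply]
    congr 1
    simp only [Complex.measurableEquivRealProd_symm_apply]
    have h2 : (2 : ℝ) * ((1 / 2 : NNReal) : ℝ) = 1 := by norm_num
    have h3 : 2 * Real.pi * ((1 / 2 : NNReal) : ℝ) = Real.pi := by
      rw [mul_right_comm, h2, one_mul]
    rw [h2, h3]
    have h4 : (√Real.pi)⁻¹ * (√Real.pi)⁻¹ = Real.pi⁻¹ := by
      rw [← mul_inv, Real.mul_self_sqrt Real.pi_pos.le]
    calc _ = ((√Real.pi)⁻¹ * (√Real.pi)⁻¹) *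
          (Real.exp (-(p.1 - 0) ^ 2 / 1) * Real.exp (-(p.2 - 0) ^ 2 / 1)) := by ring
      _ = _ := by
        rw [h4, ← Real.exp_add]
        congr 2
        ring
  rw [complexNormal, gaussianReal_of_var_ne_zero _ hv, prod_withDensity (measurable_gaussianPDF _ _)
    (measurable_gaussianPDF _ _), hfun]
  simp_rw [hdens]
  refine Measure.ext fun s hs => ?_
  rw [Measure.map_apply Complex.measurableEquivRealProd.symm.measurable hs,
    withDensity_apply _ (Complex.measurableEquivRealProd.symm.measurable hs), withDensity_apply _ hs]
  exact hmap.setLIntegral_comp_preimage hs measurable_complexNormalPDF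

instance isProbabilityMeasure_complexNormal : IsProbabilityMeasure complexNormal :=
  Measure.isProbabilityMeasure_map (by fun_prop)

variable {ι : Type*} [Fintype ι]

theorem pi_complexNormal_eq_withDensity :
    Measure.pi (fun _ : ι => complexNormal) =
      (volume : Measure (ι → ℂ)).withDensity fun x => ∏ i, complexNormalPDF (x i) := by
  have : SigmaFinite ((volume : Measure ℂ).withDensity complexNormalPDF) := by
    rw [← complexNormal_eq_withDensity]; infer_instance
  rw [complexNormal_eq_withDensity]
  exact pi_withDensity fun _ => measurable_complexNormalPDF

theorem pi_complexNormal_absolutelyContinuous :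
    Measure.pi (fun _ : ι => complexNormal) ≪ (volume : Measure (ι → ℂ)) := by
  rw [pi_complexNormal_eq_withDensity]
  exact withDensity_absolutelyContinuous _ _

theorem lintegral_exp_neg_mul_sq_norm {l : ℝ} (hl : 0 < l) :
    ∫⁻ z : ℂ, ENNReal.ofReal (Real.pi⁻¹ * Real.exp (-(l * ‖z‖ ^ 2))) = ENNReal.ofReal l⁻¹ := by
  have h := GaussianFourier.integral_rexp_neg_mul_sq_norm (V := ℂ) hl
  rw [Complex.finrank_real_complex] at h
  norm_num at h
  have hint : Integrable fun z : ℂ => Real.pi⁻¹ * Real.exp (-(l * ‖z‖ ^ 2)) := by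
    refine Integrable.const_mul (Integrable.of_integral_ne_zero ?_) _
    rw [h]
    positivity
  rw [← ofReal_integral_eq_lintegral_ofReal hint (Eventually.of_forall fun z => by positivity),
    integral_const_mul, h]
  congr 1
  field_simp

variable [DecidableEq ι]

/-- Viewed over ℝ, a complex linear map has determinant |det U|², which is 1 here, so Lebesgue
measure is preserved. -/
theorem lintegral_unitary_mulVec (U : Matrix.unitaryGroup ι ℂ) {F : (ι → ℂ) → ENNReal}
    (hF : Measurable F) :
    ∫⁻ v, F ((U : Matrix ι ι ℂ).mulVec v) = ∫⁻ v, F v := by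
  set f : (ι → ℂ) →ₗ[ℝ] (ι → ℂ) := (Matrix.mulVecLin (U : Matrix ι ι ℂ)).restrictScalars ℝ with hf
  have hdet : LinearMap.det f = 1 := by
    rw [hf, LinearMap.det_restrictScalars, Algebra.norm_complex_apply]
    have : ‖LinearMap.det (Matrix.mulVecLin (U : Matrix ι ι ℂ))‖ = 1 := by
      rw [← Matrix.toLin'_apply', LinearMap.det_toLin']
      exact CStarRing.norm_of_mem_unitary (Matrix.det_of_mem_unitary U.2)
    rw [Complex.normSq_eq_norm_sq, this, one_pow]
  have hmap := Measure.map_linearMap_addHaar_eq_smul_addHaar (volume : Measure (ι → ℂ)) (f := f)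
    (by rw [hdet]; exact one_ne_zero)
  rw [hdet, inv_one, abs_one, ENNReal.ofReal_one, one_smul] at hmap
  conv_rhs => rw [← hmap]
  rw [lintegral_map hF (LinearMap.continuous_of_finiteDimensional f).measurable]
  rfl

open scoped ComplexOrder in
/-- The complex Gaussian integral `∫ exp(-v† A v) dv = π ^ n / det A`. -/
theorem lintegral_exp_neg_posDef {A : Matrix ι ι ℂ} (hA : A.PosDef) :
    ∫⁻ v : ι → ℂ, ENNReal.ofReal ((Real.pi⁻¹) ^ Fintype.card ι *
        Real.exp (-(star v ⬝ᵥ A.mulVec v).re)) = ENNReal.ofReal (A.det.re)⁻¹ := by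
  have hH := hA.isHermitian
  have hmeas : Measurable fun v : ι → ℂ => ENNReal.ofReal ((Real.pi⁻¹) ^ Fintype.card ι *
        Real.exp (-(star v ⬝ᵥ A.mulVec v).re)) := by
    refine (ENNReal.continuous_ofReal.comp ?_).measurable
    fun_prop
  -- Rotating to an eigenbasis turns the quadratic form into ∑ λᵢ|wᵢ|², and the integral factors
  -- over coordinates.
  rw [← lintegral_unitary_mulVec hH.eigenvectorUnitary hmeas]
  have hquad : ∀ w : ι → ℂ,
      (star ((hH.eigenvectorUnitary : Matrix ι ι ℂ).mulVec w) ⬝ᵥ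
        A.mulVec ((hH.eigenvectorUnitary : Matrix ι ι ℂ).mulVec w)).re
      = ∑ i, hH.eigenvalues i * ‖w i‖ ^ 2 := by
    intro w
    have h := hH.conjStarAlgAut_star_eigenvectorUnitary
    rw [Unitary.conjStarAlgAut_star_apply] at h
    rw [Matrix.star_mulVec, ← Matrix.dotProduct_mulVec, Matrix.mulVec_mulVec, Matrix.mulVec_mulVec,
      ← Matrix.star_eq_conjTranspose, h]
    simp only [dotProduct, Matrix.mulVec_diagonal, Complex.re_sum]
    refine Finset.sum_congr rfl fun i _ => ?_
    rw [Pi.star_apply, mul_left_comm, RCLike.star_def, Complex.conj_mul']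
    change ((hH.eigenvalues i : ℂ) * (‖w i‖ : ℂ) ^ 2).re = _
    norm_cast
  have hprod : ∀ w : ι → ℂ, ENNReal.ofReal ((Real.pi⁻¹) ^ Fintype.card ι *
        Real.exp (-∑ i, hH.eigenvalues i * ‖w i‖ ^ 2))
      = ∏ i, ENNReal.ofReal (Real.pi⁻¹ * Real.exp (-(hH.eigenvalues i * ‖w i‖ ^ 2))) := by
    intro w
    rw [← ENNReal.ofReal_prod_of_nonneg fun i _ => by positivity, Finset.prod_mul_distrib,
      ← Real.exp_sum, Finset.sum_neg_distrib, Finset.prod_const, Finset.card_univ]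
  simp_rw [hquad, hprod]
  have hT := lintegral_fintype_prod_eq_prod (μ := fun _ : ι => (volume : Measure ℂ))
    (f := fun i z => ENNReal.ofReal (Real.pi⁻¹ * Real.exp (-(hH.eigenvalues i * ‖z‖ ^ 2))))
    (fun i => by fun_prop)
  rw [volume_pi, hT]
  simp_rw [fun i => lintegral_exp_neg_mul_sq_norm (hA.eigenvalues_pos i)]
  rw [← ENNReal.ofReal_prod_of_nonneg fun i _ => inv_nonneg.2 (hA.eigenvalues_pos i).le,
    hH.det_eq_prod_eigenvalues, Finset.prod_inv_distrib]
  congr 2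
  norm_cast

end gaussian

/-! ### Laplace transforms of the channel gains -/

section laplace

variable {N M : ℕ}

/-- The Laplace transform of `h† P h` for a complex Gaussian vector `h`. -/
theorem lintegral_exp_neg_zfGain (hMN : M ≤ N) {H : Matrix (Fin N) (Fin M) ℂ}
    (hdet : (H.conjTranspose * H).det ≠ 0) {s : ℝ} (hs : 0 ≤ s) :
    ∫⁻ h : Fin N → ℂ, ENNReal.ofReal (Real.exp (-(s * zfGain h H)))
      ∂(Measure.pi fun _ => complexNormal) = ENNReal.ofReal ((1 + s) ^ (N - M))⁻¹ := by
  -- The Gaussian density times e^(-s h†Ph) is π^(-N) exp(-h†(1+sP)h).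
  have key := lintegral_exp_neg_posDef (posDef_one_add_smul_zfProjection hdet hs)
  rw [det_one_add_smul_zfProjection hMN hdet hs, Complex.ofReal_re] at key
  rw [pi_complexNormal_eq_withDensity, lintegral_withDensity_eq_lintegral_mul, ← key]
  · refine lintegral_congr fun h => ?_
    simp only [Pi.mul_apply, complexNormalPDF]
    rw [← ENNReal.ofReal_prod_of_nonneg fun i _ => by positivity,
      ← ENNReal.ofReal_mul (Finset.prod_nonneg fun i _ => by positivity),
      Finset.prod_mul_distrib, ← Real.exp_sum, Finset.prod_const, Finset.card_univ, mul_assoc,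
      ← Real.exp_add, Matrix.add_mulVec, Matrix.one_mulVec, dotProduct_add, Matrix.smul_mulVec,
      dotProduct_smul, dotProduct_star_self_eq_normSqF, Complex.add_re, Complex.ofReal_re,
      smul_eq_mul, Complex.re_ofReal_mul, Finset.sum_neg_distrib, neg_add, normSqF, zfGain]
  · exact Finset.measurable_prod _ fun i _ => measurable_complexNormalPDF.comp (measurable_pi_apply i)
  · unfold zfGain
    refine (ENNReal.continuous_ofReal.comp ?_).measurable
    fun_prop

/-- The case of no interferers, where the projection is the identity. -/
theorem lintegral_exp_neg_normSqF {s : ℝ} (hs : 0 ≤ s) :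
    ∫⁻ h : Fin N → ℂ, ENNReal.ofReal (Real.exp (-(s * normSqF h)))
      ∂(Measure.pi fun _ => complexNormal) = ENNReal.ofReal ((1 + s) ^ N)⁻¹ := by
  have h := lintegral_exp_neg_zfGain (N := N) (M := 0) (Nat.zero_le _) (H := 0) (by simp) hs
  rw [Nat.sub_zero] at h
  rw [← h]
  refine lintegral_congr fun v => ?_
  rw [zfGain, zfProjection, Matrix.zero_mul, Matrix.zero_mul, sub_zero, Matrix.one_mulVec,
    dotProduct_star_self_eq_normSqF, Complex.ofReal_re]

end laplace

/-! ### Almost sure invertibility of `H† H` -/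

section invertible

variable {N M : ℕ}

open scoped ComplexOrder in
-- Move H along the matrix whose top M × M block is the identity. If the Gram matrix is singular at
-- `t`, then H + tE kills a nonzero vector, and so does its top block A + t. Thus `t` is a root of
-- the characteristic polynomial of -A.
theorem finite_setOf_det_conjTranspose_mul_self_eq_zero (hMN : M ≤ N)
    (H : Matrix (Fin N) (Fin M) ℂ) :
    {t : ℝ | ((H + (t : ℂ) • Matrix.of fun n m => if n = Fin.castLE hMN m then 1 else 0).conjTranspose *
      (H + (t : ℂ) • Matrix.of fun n m => if n = Fin.castLE hMN m then 1 else 0)).det = 0}.Finite := by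
  set A : Matrix (Fin M) (Fin M) ℂ := H.submatrix (Fin.castLE hMN) id with hA
  have hfin : {z : ℂ | (-A).charpoly.eval z = 0}.Finite := by
    refine ((-A).charpoly.roots.toFinset.finite_toSet).subset fun z hz => ?_
    simp only [Finset.mem_coe, Multiset.mem_toFinset]
    exact (Polynomial.mem_roots (Matrix.charpoly_monic _).ne_zero).2 hz
  refine (hfin.preimage (f := fun t : ℝ => (t : ℂ)) Complex.ofReal_injective.injOn).subset
    fun t ht => ?_
  obtain ⟨v, hv, hv0⟩ := Matrix.exists_mulVec_eq_zero_iff.2 ht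
  rw [Matrix.conjTranspose_mul_self_mulVec_eq_zero] at hv0
  change (-A).charpoly.eval (t : ℂ) = 0
  rw [Matrix.eval_charpoly, sub_neg_eq_add]
  refine Matrix.exists_mulVec_eq_zero_iff.1 ⟨v, hv, ?_⟩
  funext m
  have := congrFun hv0 (Fin.castLE hMN m)
  rw [Matrix.add_mulVec, Matrix.smul_mulVec, Pi.add_apply, Pi.smul_apply] at this
  rw [add_comm, Matrix.add_mulVec, Pi.add_apply]
  refine Eq.trans ?_ this
  congr 1
  simp [Matrix.mulVec, dotProduct, Matrix.scalar_apply, Matrix.diagonal_apply]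

/-- A Gaussian matrix with at least as many rows as columns almost surely has full rank. -/
theorem ae_det_conjTranspose_mul_self_ne_zero (hMN : M ≤ N) :
    ∀ᵐ x : Fin N × Fin M → ℂ ∂(Measure.pi fun _ => complexNormal),
      ((Matrix.of fun n m => x (n, m)).conjTranspose * (Matrix.of fun n m => x (n, m))).det ≠ 0 := by
  refine pi_complexNormal_absolutelyContinuous.ae_le ?_
  set e : Fin N × Fin M → ℂ := fun q => if q.1 = Fin.castLE hMN q.2 then 1 else 0 with he
  set L : ℝ →ₗ[ℝ] (Fin N × Fin M → ℂ) := LinearMap.toSpanSingleton ℝ _ e with hL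
  have hcont : Continuous fun x : Fin N × Fin M → ℂ =>
      ((Matrix.of fun n m => x (n, m)).conjTranspose * (Matrix.of fun n m => x (n, m))).det := by
    have : Continuous fun x : Fin N × Fin M → ℂ =>
        (Matrix.of fun n m => x (n, m) : Matrix (Fin N) (Fin M) ℂ) :=
      continuous_matrix fun i j => continuous_apply (i, j)
    exact (this.matrix_conjTranspose.matrix_mul this).matrix_det
  -- Fubini along parallel lines: a measurable set that is conull on every translate of one line is
  -- conull.
  refine ae_mem_of_ae_add_linearMap_mem (s := {x | _}) L (volume : Measure ℝ) volume
    (isOpen_ne_fun hcont continuous_const).measurableSet fun y => ?_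
  have hfin := finite_setOf_det_conjTranspose_mul_self_eq_zero hMN (Matrix.of fun n m => y (n, m))
  refine (hfin.countable.ae_notMem volume).mono fun t ht h0 => ht ?_
  have : (Matrix.of fun n m => (y + L t) (n, m) : Matrix (Fin N) (Fin M) ℂ)
      = Matrix.of (fun n m => y (n, m)) +
        (t : ℂ) • Matrix.of fun n m => if n = Fin.castLE hMN m then 1 else 0 := by
    ext n m
    simp [hL, he, LinearMap.toSpanSingleton_apply]
  rw [this] at h0
  exact h0

end invertible

/-! ### Frullani integrals -/

section frullani

/-- The integrand is ∫_p^q e^(-ut) du; Tonelli leaves ∫_p^q du/u. -/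
theorem lintegral_exp_sub_exp_div {p q : ℝ} (hp : 0 < p) (hpq : p ≤ q) :
    ∫⁻ t in Set.Ioi (0 : ℝ), ENNReal.ofReal ((Real.exp (-(p * t)) - Real.exp (-(q * t))) / t)
      = ENNReal.ofReal (Real.log (q / p)) := by
  have h1 : ∀ t ∈ Set.Ioi (0 : ℝ),
      ENNReal.ofReal ((Real.exp (-(p * t)) - Real.exp (-(q * t))) / t)
        = ∫⁻ u in Set.Ioc p q, ENNReal.ofReal (Real.exp (-(u * t))) := by
    intro t ht
    have ht0 : (t : ℝ) ≠ 0 := ne_of_gt ht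
    have hd : ∀ u ∈ Set.uIcc p q,
        HasDerivAt (fun u : ℝ => -(Real.exp (-(u * t)) / t)) (Real.exp (-(u * t))) u := by
      intro u _
      have h : HasDerivAt (fun u : ℝ => -(Real.exp (-(u * t)) / t))
          (-(Real.exp (-(u * t)) * -(1 * t) / t)) u :=
        (((hasDerivAt_id u).mul_const t).neg.exp.div_const t).neg
      refine h.congr_deriv ?_
      field_simp
    have hint : IntervalIntegrable (fun u : ℝ => Real.exp (-(u * t))) volume p q :=
      Continuous.intervalIntegrable (by fun_prop) _ _
    have hval := intervalIntegral.integral_eq_sub_of_hasDerivAt hd hint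
    rw [intervalIntegral.integral_of_le hpq] at hval
    rw [← ofReal_integral_eq_lintegral_ofReal
      ((intervalIntegrable_iff_integrableOn_Ioc_of_le hpq).1 hint)
      (Eventually.of_forall fun u => (Real.exp_pos _).le), hval]
    congr 1
    ring
  rw [setLIntegral_congr_fun measurableSet_Ioi h1, lintegral_lintegral_swap]
  · have h2 : ∀ u ∈ Set.Ioc p q, ∫⁻ t in Set.Ioi (0 : ℝ), ENNReal.ofReal (Real.exp (-(u * t)))
        = ENNReal.ofReal u⁻¹ := by
      intro u hu
      have hu0 : 0 < u := hp.trans hu.1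
      have hi := integrableOn_exp_mul_Ioi (a := -u) (by linarith) 0
      have hv := integral_exp_mul_Ioi (a := -u) (by linarith) 0
      simp only [neg_mul] at hi hv
      rw [← ofReal_integral_eq_lintegral_ofReal hi
        (Eventually.of_forall fun u => (Real.exp_pos _).le), hv]
      congr 1
      simp [div_eq_mul_inv]
    rw [setLIntegral_congr_fun measurableSet_Ioc h2]
    have h0 : (0 : ℝ) ∉ Set.uIcc p q := by
      rw [Set.uIcc_of_le hpq]
      exact fun h => absurd h.1 (not_le.2 hp)
    have hint : IntervalIntegrable (fun u : ℝ => u⁻¹) volume p q :=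
      intervalIntegrable_inv_iff.2 (Or.inr h0)
    rw [← ofReal_integral_eq_lintegral_ofReal
      ((intervalIntegrable_iff_integrableOn_Ioc_of_le hpq).1 hint)
      ((ae_restrict_mem measurableSet_Ioc).mono fun u hu => inv_nonneg.2 (hp.trans hu.1).le),
      ← intervalIntegral.integral_of_le hpq, integral_inv h0]
  · exact Measurable.aemeasurable (by fun_prop)

/-- A Frullani-type representation of `log (1 + a b / (1 + a + b))`. -/
theorem lintegral_exp_div_mul_one_sub_exp {a b : ℝ} (ha : 0 ≤ a) (hb : 0 ≤ b) :
    ∫⁻ t in Set.Ioi (0 : ℝ), ENNReal.ofReal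
        (Real.exp (-t) / t * ((1 - Real.exp (-(a * t))) * (1 - Real.exp (-(b * t)))))
      = ENNReal.ofReal (Real.log (1 + a * b / (1 + a + b))) := by
  have e1 := lintegral_exp_sub_exp_div (p := 1) (q := 1 + a) one_pos (by linarith)
  have e2 := lintegral_exp_sub_exp_div (p := 1 + b) (q := 1 + a + b) (by linarith) (by linarith)
  have hexp : ∀ c : ℝ, 0 ≤ c → ∀ t ∈ Set.Ioi (0 : ℝ), 0 ≤ 1 - Real.exp (-(c * t)) := by
    intro c hc t ht
    have : 0 ≤ c * t := mul_nonneg hc (le_of_lt ht)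
    linarith [Real.exp_le_one_iff.2 (neg_nonpos.2 this)]
  -- The expanded product is the Frullani integrand for (1, 1+a) minus that for (1+b, 1+a+b). It is
  -- stated as a sum of nonnegative terms because subtraction in `ENNReal` truncates.
  have hsum : ∀ t ∈ Set.Ioi (0 : ℝ),
      ENNReal.ofReal ((Real.exp (-(1 * t)) - Real.exp (-((1 + a) * t))) / t)
      = ENNReal.ofReal
        (Real.exp (-t) / t * ((1 - Real.exp (-(a * t))) * (1 - Real.exp (-(b * t)))))
        + ENNReal.ofReal ((Real.exp (-((1 + b) * t)) - Real.exp (-((1 + a + b) * t))) / t) := by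
    intro t ht
    have ht0 : (0 : ℝ) < t := ht
    have ea : Real.exp (-((1 + a) * t)) = Real.exp (-t) * Real.exp (-(a * t)) := by
      rw [← Real.exp_add]; congr 1; ring
    have eb : Real.exp (-((1 + b) * t)) = Real.exp (-t) * Real.exp (-(b * t)) := by
      rw [← Real.exp_add]; congr 1; ring
    have eab : Real.exp (-((1 + a + b) * t))
        = Real.exp (-t) * Real.exp (-(b * t)) * Real.exp (-(a * t)) := by
      rw [← Real.exp_add, ← Real.exp_add]; congr 1; ring
    have hA := hexp a ha t ht
    have hB := hexp b hb t ht
    rw [← ENNReal.ofReal_add]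
    · congr 1
      rw [ea, eb, eab, one_mul]
      ring
    · positivity
    · rw [eb, eab, ← mul_one_sub]
      positivity
  rw [setLIntegral_congr_fun measurableSet_Ioi hsum, lintegral_add_right _ (by fun_prop), e2] at e1
  have hl2 : 0 ≤ Real.log ((1 + a + b) / (1 + b)) :=
    Real.log_nonneg ((one_le_div (by linarith)).2 (by linarith))
  rw [ENNReal.eq_sub_of_add_eq ENNReal.ofReal_ne_top e1, ← ENNReal.ofReal_sub _ hl2,
    ← Real.log_div (by positivity) (by positivity)]
  congr 2
  field_simp
  ring

end frullani

/-! ### The mean of `log (1 + γ)` -/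

section expectation

variable {N M : ℕ}

/-- The interference channel matrix with the given entries. -/
def channelMatrix (x : Fin N × Fin M → ℂ) : Matrix (Fin N) (Fin M) ℂ := Matrix.of fun n m => x (n, m)

theorem continuous_channelMatrix :
    Continuous (channelMatrix : (Fin N × Fin M → ℂ) → Matrix (Fin N) (Fin M) ℂ) :=
  continuous_matrix fun i j => continuous_apply (i, j)

/-- The adjugate form is continuous apart from one scalar inverse, which makes the gain measurable
even across singular H†H. -/
theorem zfGain_eq_det_inv_mul (h : Fin N → ℂ) (H : Matrix (Fin N) (Fin M) ℂ) :
    zfGain h H = (star h ⬝ᵥ h - (H.conjTranspose * H).det⁻¹ *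
      (star h ⬝ᵥ (H * (H.conjTranspose * H).adjugate * H.conjTranspose).mulVec h)).re := by
  rw [zfGain, zfProjection, Matrix.inv_def, Ring.inverse_eq_inv', Matrix.mul_smul, Matrix.smul_mul,
    Matrix.sub_mulVec, Matrix.one_mulVec, dotProduct_sub, Matrix.smul_mulVec, dotProduct_smul,
    smul_eq_mul]

theorem measurable_zfGain {α : Type*} [MeasurableSpace α] {h : α → Fin N → ℂ}
    {x : α → Fin N × Fin M → ℂ} (hh : Measurable h) (hx : Measurable x) :
    Measurable fun p => zfGain (h p) (channelMatrix (x p)) := by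
  have hp : Measurable fun p => (h p, x p) := hh.prodMk hx
  refine Measurable.comp (g := fun q : (Fin N → ℂ) × (Fin N × Fin M → ℂ) =>
    zfGain q.1 (channelMatrix q.2)) ?_ hp
  simp_rw [zfGain_eq_det_inv_mul]
  have hH : Continuous fun q : (Fin N → ℂ) × (Fin N × Fin M → ℂ) =>
      (channelMatrix q.2 : Matrix (Fin N) (Fin M) ℂ) := continuous_channelMatrix.comp continuous_snd
  have hH' := hH.matrix_conjTranspose
  have hG := hH'.matrix_mul hH
  have h1 : Continuous fun q : (Fin N → ℂ) × (Fin N × Fin M → ℂ) => star q.1 ⬝ᵥ q.1 :=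
    continuous_fst.star.dotProduct continuous_fst
  have h2 := continuous_fst.star.dotProduct
    (((hH.matrix_mul hG.matrix_adjugate).matrix_mul hH').matrix_mulVec
      (continuous_fst (X := Fin N → ℂ) (Y := Fin N × Fin M → ℂ)))
  exact Complex.measurable_re.comp
    (h1.measurable.sub (hG.matrix_det.measurable.inv.mul h2.measurable))

theorem continuous_normSqF : Continuous (normSqF : (Fin N → ℂ) → ℝ) := by
  unfold normSqF
  fun_prop

theorem lintegral_one_sub_exp_neg {α : Type*} [MeasurableSpace α] {ν : Measure α}
    [IsProbabilityMeasure ν] {X : α → ℝ} (hX : Measurable X) (h0 : ∀ x, 0 ≤ X x) {c : ℝ}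
    (hc : 0 ≤ c) (hL : ∫⁻ x, ENNReal.ofReal (Real.exp (-X x)) ∂ν = ENNReal.ofReal c) :
    ∫⁻ x, ENNReal.ofReal (1 - Real.exp (-X x)) ∂ν = ENNReal.ofReal (1 - c) := by
  simp_rw [fun x => ENNReal.ofReal_sub 1 (Real.exp_pos (-X x)).le]
  rw [lintegral_sub (by fun_prop) (by rw [hL]; exact ENNReal.ofReal_ne_top), hL,
    ENNReal.ofReal_sub _ hc]
  · simp
  · refine Eventually.of_forall fun x => ENNReal.ofReal_le_ofReal ?_
    exact Real.exp_le_one_iff.2 (neg_nonpos.2 (h0 x))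

/-- The joint law of `h₁`, the entries of `H` and `h₂`. -/
abbrev channelLaw (N M : ℕ) : Measure ((Fin N → ℂ) × ((Fin N × Fin M → ℂ) × (Fin N → ℂ))) :=
  (Measure.pi fun _ => complexNormal).prod
    ((Measure.pi fun _ => complexNormal).prod (Measure.pi fun _ => complexNormal))

theorem ae_channelLaw_det_ne_zero (hMN : M ≤ N) :
    ∀ᵐ p ∂(channelLaw N M),
      ((channelMatrix p.2.1).conjTranspose * channelMatrix p.2.1).det ≠ 0 :=
  (Measure.quasiMeasurePreserving_fst.comp Measure.quasiMeasurePreserving_snd).ae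
    (ae_det_conjTranspose_mul_self_ne_zero hMN)

/-- Integrate over h₁ first, with H frozen: the result is the same for almost every H, so only the
mean over h₂ remains. -/
theorem lintegral_one_sub_exp_mul_one_sub_exp (hMN : M ≤ N) {r s : ℝ} (hr : 0 ≤ r) (hs : 0 ≤ s) :
    ∫⁻ p, ENNReal.ofReal (1 - Real.exp (-(r * zfGain p.1 (channelMatrix p.2.1)))) *
        ENNReal.ofReal (1 - Real.exp (-(s * normSqF p.2.2))) ∂(channelLaw N M)
      = ENNReal.ofReal (1 - ((1 + r) ^ (N - M))⁻¹) * ENNReal.ofReal (1 - ((1 + s) ^ N)⁻¹) := by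
  have hm1 : Measurable fun p : (Fin N → ℂ) × ((Fin N × Fin M → ℂ) × (Fin N → ℂ)) =>
      zfGain p.1 (channelMatrix p.2.1) := measurable_zfGain (by fun_prop) (by fun_prop)
  have hm2 : Measurable (normSqF : (Fin N → ℂ) → ℝ) := continuous_normSqF.measurable
  have hm : Measurable fun p : (Fin N → ℂ) × ((Fin N × Fin M → ℂ) × (Fin N → ℂ)) =>
      ENNReal.ofReal (1 - Real.exp (-(r * zfGain p.1 (channelMatrix p.2.1)))) *
        ENNReal.ofReal (1 - Real.exp (-(s * normSqF p.2.2))) := by fun_prop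
  rw [lintegral_prod_symm _ hm.aemeasurable]
  have hin : ∀ᵐ q : (Fin N × Fin M → ℂ) × (Fin N → ℂ)
      ∂((Measure.pi fun _ => complexNormal).prod (Measure.pi fun _ => complexNormal)),
      ∫⁻ h, ENNReal.ofReal (1 - Real.exp (-(r * zfGain h (channelMatrix q.1)))) *
        ENNReal.ofReal (1 - Real.exp (-(s * normSqF q.2))) ∂(Measure.pi fun _ => complexNormal)
      = ENNReal.ofReal (1 - ((1 + r) ^ (N - M))⁻¹) *
        ENNReal.ofReal (1 - Real.exp (-(s * normSqF q.2))) := by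
    refine (Measure.quasiMeasurePreserving_fst.ae
      (ae_det_conjTranspose_mul_self_ne_zero hMN)).mono fun q hq => ?_
    have hmq : Measurable fun h : Fin N → ℂ => r * zfGain h (channelMatrix q.1) :=
      (measurable_zfGain measurable_id (x := fun _ => q.1) measurable_const).const_mul r
    rw [lintegral_mul_const _ (by fun_prop), lintegral_one_sub_exp_neg hmq
      (fun h => mul_nonneg hr (zfGain_nonneg hq h)) (by positivity)
      (lintegral_exp_neg_zfGain hMN hq hr)]
  rw [lintegral_congr_ae hin, lintegral_const_mul _ (by fun_prop)]
  congr 1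
  have hsnd := (measurePreserving_snd (μ := Measure.pi fun _ : Fin N × Fin M => complexNormal)
    (ν := Measure.pi fun _ : Fin N => complexNormal)).lintegral_comp
      (f := fun h => ENNReal.ofReal (1 - Real.exp (-(s * normSqF h)))) (by fun_prop)
  rw [hsnd]
  exact lintegral_one_sub_exp_neg (hm2.const_mul s) (fun h => mul_nonneg hs (normSqF_nonneg h))
    (by positivity) (lintegral_exp_neg_normSqF hs)

theorem one_sub_inv_pow_eq_mul_sum {s : ℝ} (hs : 0 ≤ s) (m : ℕ) :
    1 - ((1 + s) ^ m)⁻¹ = s * ∑ k ∈ Finset.range m, (1 / (1 + s)) ^ (k + 1) := by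
  have h := mul_neg_geom_sum (1 / (1 + s)) m
  have h1 : (1 + s) ≠ 0 := by positivity
  simp_rw [pow_succ, ← Finset.sum_mul]
  rw [← inv_pow, ← one_div, ← h]
  field_simp
  ring

/-- The function `t exp(-t) (1 + ρ₁ t)⁻ᵏ⁻¹ (1 + ρ₂ t)⁻ʲ⁻¹`. -/
def gainIntegrand (ρ₁ ρ₂ : ℝ) (k j : ℕ) (t : ℝ) : ℝ :=
  t * Real.exp (-t) * (1 / (1 + ρ₁ * t)) ^ (k + 1) * (1 / (1 + ρ₂ * t)) ^ (j + 1)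

theorem gainIntegrand_nonneg {ρ₁ ρ₂ : ℝ} (h₁ : 0 < ρ₁) (h₂ : 0 < ρ₂) (k j : ℕ) {t : ℝ}
    (ht : t ∈ Set.Ioi (0 : ℝ)) : 0 ≤ gainIntegrand ρ₁ ρ₂ k j t := by
  have ht' : (0 : ℝ) < t := ht
  unfold gainIntegrand
  positivity

theorem integrableOn_gainIntegrand {ρ₁ ρ₂ : ℝ} (h₁ : 0 < ρ₁) (h₂ : 0 < ρ₂) (k j : ℕ) :
    IntegrableOn (gainIntegrand ρ₁ ρ₂ k j) (Set.Ioi 0) := by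
  -- Both rational factors are at most 1, so the integrand of Γ(2) dominates.
  have hG := Real.GammaIntegral_convergent (s := 2) (by norm_num)
  refine Integrable.mono' hG (Measurable.aestronglyMeasurable ?_)
    ((ae_restrict_mem measurableSet_Ioi).mono fun t ht => ?_)
  · unfold gainIntegrand
    fun_prop
  · have ht' : (0 : ℝ) < t := ht
    rw [Real.norm_of_nonneg (gainIntegrand_nonneg h₁ h₂ k j ht)]
    have hle : ∀ ρ : ℝ, 0 < ρ → ∀ n : ℕ, (1 / (1 + ρ * t)) ^ n ≤ 1 := fun ρ hρ n =>
      pow_le_one₀ (by positivity) ((div_le_one (by positivity)).2 (by nlinarith [mul_pos hρ ht']))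
    have e : Real.exp (-t) * t ^ ((2 : ℝ) - 1) = t * Real.exp (-t) := by
      norm_num
      ring
    rw [e, gainIntegrand]
    have hp : 0 ≤ t * Real.exp (-t) := by positivity
    exact (mul_le_of_le_one_right (by positivity) (hle _ h₂ _)).trans
      (mul_le_of_le_one_right hp (hle _ h₁ _))

/-- The mean of `log (1 + γ)` for the ZF/MRT scheme. -/
theorem lintegral_log_one_add_sinr (hMN : M ≤ N) {ρ₁ ρ₂ : ℝ} (h₁ : 0 < ρ₁) (h₂ : 0 < ρ₂) :
    ∫⁻ p, ENNReal.ofReal (Real.log (1 +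
        (ρ₁ * zfGain p.1 (channelMatrix p.2.1)) * (ρ₂ * normSqF p.2.2) /
          (1 + ρ₁ * zfGain p.1 (channelMatrix p.2.1) + ρ₂ * normSqF p.2.2))) ∂(channelLaw N M)
      = ENNReal.ofReal (ρ₁ * ρ₂ * ∑ k ∈ Finset.range (N - M), ∑ j ∈ Finset.range N,
        ∫ t in Set.Ioi (0 : ℝ), gainIntegrand ρ₁ ρ₂ k j t) := by
  have hm1 : Measurable fun p : (Fin N → ℂ) × ((Fin N × Fin M → ℂ) × (Fin N → ℂ)) =>
      zfGain p.1 (channelMatrix p.2.1) := measurable_zfGain (by fun_prop) (by fun_prop)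
  have hm2 : Measurable (normSqF : (Fin N → ℂ) → ℝ) := continuous_normSqF.measurable
  have e1 : ∀ᵐ p ∂(channelLaw N M), ENNReal.ofReal (Real.log (1 +
        (ρ₁ * zfGain p.1 (channelMatrix p.2.1)) * (ρ₂ * normSqF p.2.2) /
          (1 + ρ₁ * zfGain p.1 (channelMatrix p.2.1) + ρ₂ * normSqF p.2.2)))
      = ∫⁻ t in Set.Ioi (0 : ℝ), ENNReal.ofReal
        (Real.exp (-t) / t * ((1 - Real.exp (-(ρ₁ * zfGain p.1 (channelMatrix p.2.1) * t))) *
          (1 - Real.exp (-(ρ₂ * normSqF p.2.2 * t))))) := by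
    refine (ae_channelLaw_det_ne_zero hMN).mono fun p hp => ?_
    exact (lintegral_exp_div_mul_one_sub_exp (mul_nonneg h₁.le (zfGain_nonneg hp _))
      (mul_nonneg h₂.le (normSqF_nonneg _))).symm
  have hq1 : Measurable fun q : ((Fin N → ℂ) × ((Fin N × Fin M → ℂ) × (Fin N → ℂ))) × ℝ =>
      zfGain q.1.1 (channelMatrix q.1.2.1) := hm1.comp measurable_fst
  rw [lintegral_congr_ae e1, lintegral_lintegral_swap (Measurable.aemeasurable (by
    simp only [Function.uncurry_def]; fun_prop))]
  -- The two geometric sums supply factors ρ₁t and ρ₂t; one `t` cancels the 1/t of Frullani's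
  -- formula and the other stays in `gainIntegrand`.
  have e2 : ∀ t ∈ Set.Ioi (0 : ℝ), ∫⁻ p, ENNReal.ofReal
        (Real.exp (-t) / t * ((1 - Real.exp (-(ρ₁ * zfGain p.1 (channelMatrix p.2.1) * t))) *
          (1 - Real.exp (-(ρ₂ * normSqF p.2.2 * t))))) ∂(channelLaw N M)
      = ENNReal.ofReal (ρ₁ * ρ₂ * ∑ k ∈ Finset.range (N - M), ∑ j ∈ Finset.range N,
        gainIntegrand ρ₁ ρ₂ k j t) := by
    intro t ht
    have ht' : (0 : ℝ) < t := ht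
    have hr : 0 ≤ ρ₁ * t := by positivity
    have hs : 0 ≤ ρ₂ * t := by positivity
    have e3 : ∀ᵐ p ∂(channelLaw N M), ENNReal.ofReal
        (Real.exp (-t) / t * ((1 - Real.exp (-(ρ₁ * zfGain p.1 (channelMatrix p.2.1) * t))) *
          (1 - Real.exp (-(ρ₂ * normSqF p.2.2 * t)))))
        = ENNReal.ofReal (Real.exp (-t) / t) *
          (ENNReal.ofReal (1 - Real.exp (-(ρ₁ * t * zfGain p.1 (channelMatrix p.2.1)))) *
        ENNReal.ofReal (1 - Real.exp (-(ρ₂ * t * normSqF p.2.2)))) := by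
      refine (ae_channelLaw_det_ne_zero hMN).mono fun p hp => ?_
      have h0 := mul_nonneg hr (zfGain_nonneg hp p.1)
      rw [ENNReal.ofReal_mul (by positivity), mul_right_comm ρ₁ _ t, mul_right_comm ρ₂ _ t,
        ENNReal.ofReal_mul]
      linarith [Real.exp_le_one_iff.2 (neg_nonpos.2 h0)]
    have hsum1 := one_sub_inv_pow_eq_mul_sum hr (N - M)
    have hsum2 := one_sub_inv_pow_eq_mul_sum hs N
    have hn1 : 0 ≤ 1 - ((1 + ρ₁ * t) ^ (N - M))⁻¹ := by rw [hsum1]; positivity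
    rw [lintegral_congr_ae e3, lintegral_const_mul _ (by fun_prop),
      lintegral_one_sub_exp_mul_one_sub_exp hMN hr hs, ← ENNReal.ofReal_mul hn1,
      ← ENNReal.ofReal_mul (by positivity), hsum1, hsum2]
    congr 1
    rw [mul_mul_mul_comm, Finset.sum_mul_sum, Finset.mul_sum, Finset.mul_sum, Finset.mul_sum]
    refine Finset.sum_congr rfl fun k _ => ?_
    rw [Finset.mul_sum, Finset.mul_sum, Finset.mul_sum]
    refine Finset.sum_congr rfl fun j _ => ?_
    rw [gainIntegrand]
    field_simp
  rw [setLIntegral_congr_fun measurableSet_Ioi e2]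
  have hI : IntegrableOn (fun t => ∑ k ∈ Finset.range (N - M), ∑ j ∈ Finset.range N,
        gainIntegrand ρ₁ ρ₂ k j t) (Set.Ioi 0) :=
    integrable_finsetSum _ fun k _ => integrable_finsetSum _ fun j _ =>
      integrableOn_gainIntegrand h₁ h₂ k j
  rw [← ofReal_integral_eq_lintegral_ofReal (hI.const_mul _), integral_const_mul,
    integral_finsetSum _ fun k _ => integrable_finsetSum _ fun j _ =>
      integrableOn_gainIntegrand h₁ h₂ k j]
  · simp_rw [fun k => integral_finsetSum (μ := volume.restrict (Set.Ioi (0 : ℝ))) (Finset.range N)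
      fun j _ => integrableOn_gainIntegrand h₁ h₂ k j]
  · refine (ae_restrict_mem measurableSet_Ioi).mono fun t ht => ?_
    exact mul_nonneg (by positivity) (Finset.sum_nonneg fun k _ => Finset.sum_nonneg fun j _ =>
      gainIntegrand_nonneg h₁ h₂ k j ht)

/-- The logarithm is almost surely nonnegative, so the finite Lebesgue integral yields integrability
and the mean at once. -/
theorem integrable_integral_log_one_add_sinr (hMN : M ≤ N) {ρ₁ ρ₂ : ℝ} (h₁ : 0 < ρ₁)
    (h₂ : 0 < ρ₂) :
    Integrable (fun p => Real.log (1 +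
        (ρ₁ * zfGain p.1 (channelMatrix p.2.1)) * (ρ₂ * normSqF p.2.2) /
          (1 + ρ₁ * zfGain p.1 (channelMatrix p.2.1) + ρ₂ * normSqF p.2.2))) (channelLaw N M) ∧
    ∫ p, Real.log (1 +
        (ρ₁ * zfGain p.1 (channelMatrix p.2.1)) * (ρ₂ * normSqF p.2.2) /
          (1 + ρ₁ * zfGain p.1 (channelMatrix p.2.1) + ρ₂ * normSqF p.2.2)) ∂(channelLaw N M)
      = ρ₁ * ρ₂ * ∑ k ∈ Finset.range (N - M), ∑ j ∈ Finset.range N,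
        ∫ t in Set.Ioi (0 : ℝ), gainIntegrand ρ₁ ρ₂ k j t := by
  have hm1 : Measurable fun p : (Fin N → ℂ) × ((Fin N × Fin M → ℂ) × (Fin N → ℂ)) =>
      zfGain p.1 (channelMatrix p.2.1) := measurable_zfGain (by fun_prop) (by fun_prop)
  have hm2 : Measurable (normSqF : (Fin N → ℂ) → ℝ) := continuous_normSqF.measurable
  have hmeas : AEStronglyMeasurable (fun p => Real.log (1 +
        (ρ₁ * zfGain p.1 (channelMatrix p.2.1)) * (ρ₂ * normSqF p.2.2) /
          (1 + ρ₁ * zfGain p.1 (channelMatrix p.2.1) + ρ₂ * normSqF p.2.2))) (channelLaw N M) :=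
    Measurable.aestronglyMeasurable (by fun_prop)
  have hnn : 0 ≤ᵐ[channelLaw N M] fun p => Real.log (1 +
        (ρ₁ * zfGain p.1 (channelMatrix p.2.1)) * (ρ₂ * normSqF p.2.2) /
          (1 + ρ₁ * zfGain p.1 (channelMatrix p.2.1) + ρ₂ * normSqF p.2.2)) := by
    refine (ae_channelLaw_det_ne_zero hMN).mono fun p hp => ?_
    have ha := mul_nonneg h₁.le (zfGain_nonneg hp p.1)
    have hb := mul_nonneg h₂.le (normSqF_nonneg p.2.2)
    exact Real.log_nonneg (le_add_of_nonneg_right (by positivity))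
  have hL := lintegral_log_one_add_sinr hMN h₁ h₂
  refine ⟨(lintegral_ofReal_ne_top_iff_integrable hmeas hnn).1 (hL ▸ ENNReal.ofReal_ne_top), ?_⟩
  rw [integral_eq_lintegral_of_nonneg_ae hnn hmeas, hL, ENNReal.toReal_ofReal]
  exact mul_nonneg (by positivity) (Finset.sum_nonneg fun k _ => Finset.sum_nonneg fun j _ =>
    setIntegral_nonneg measurableSet_Ioi fun t ht => gainIntegrand_nonneg h₁ h₂ k j ht)

theorem hasLaw_channel {Ω : Type*} [MeasurableSpace Ω] {μ : Measure Ω} [IsProbabilityMeasure μ]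
    {h₁ : Ω → Fin N → ℂ} {H : Ω → Matrix (Fin N) (Fin M) ℂ} {h₂ : Ω → Fin N → ℂ}
    (hlaw : ∀ e, HasLaw (channelEntry h₁ H h₂ e) complexNormal μ)
    (hindep : iIndepFun (channelEntry h₁ H h₂) μ) :
    HasLaw (fun ω => (h₁ ω, ((fun q : Fin N × Fin M => H ω q.1 q.2), h₂ ω))) (channelLaw N M) μ := by
  have hX := hindep.hasLaw_pi hlaw
  have e1 := measurePreserving_sumPiEquivProdPi (ι := Fin N) (ι' := (Fin N × Fin M) ⊕ Fin N)
    (X := fun _ => ℂ) (fun _ => complexNormal)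
  have e2 := measurePreserving_sumPiEquivProdPi (ι := Fin N × Fin M) (ι' := Fin N)
    (X := fun _ => ℂ) (fun _ => complexNormal)
  exact (((MeasurePreserving.id _).prod e2).comp e1).comp_hasLaw hX

/-- With c = -k the exponent 1-c is k+1, and its gamma value is k!; likewise for j. -/
theorem meijerG2_eq_integral_gainIntegrand {σ τ ρ₁ ρ₂ : ℝ} {k j : ℕ}
    (hc : IsMeijerG2Contour 2 (-(k : ℝ)) (-(j : ℝ)) 0 0 σ τ) (h₁ : 0 < ρ₁) (h₂ : 0 < ρ₂) :
    meijerG2 σ τ 2 (-(k : ℝ)) (-(j : ℝ)) 0 0 ρ₁ ρ₂ = (k.factorial : ℂ) * (j.factorial : ℂ) *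
      ((∫ t in Set.Ioi (0 : ℝ), gainIntegrand ρ₁ ρ₂ k j t : ℝ) : ℂ) := by
  have e : ∀ n : ℕ, (1 : ℝ) - -(n : ℝ) = n + 1 := fun n => by ring
  have hI : ∫ t in Set.Ioi (0 : ℝ), t ^ ((2 : ℝ) - 1) * Real.exp (-t) *
          (1 / (1 + ρ₁ * t)) ^ ((k : ℝ) + 1) * (1 / (1 + ρ₂ * t)) ^ ((j : ℝ) + 1)
      = ∫ t in Set.Ioi (0 : ℝ), gainIntegrand ρ₁ ρ₂ k j t := by
    refine setIntegral_congr_fun measurableSet_Ioi fun t _ => ?_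
    simp only [gainIntegrand]
    rw [← Nat.cast_add_one, ← Nat.cast_add_one, Real.rpow_natCast, Real.rpow_natCast,
      show (2 : ℝ) - 1 = 1 by norm_num, Real.rpow_one]
  rw [meijerG2_eq_integral hc h₁ h₂, e, e, Real.Gamma_nat_eq_factorial, Real.Gamma_nat_eq_factorial,
    hI]
  push_cast
  rfl

end expectation

end

/-! ### The capacity formula -/

theorem theorem3 {Ω : Type*} [MeasurableSpace Ω] (μ : Measure Ω) [IsProbabilityMeasure μ]
    (N M : ℕ) (hMN : M < N)
    (P Pr N₀ ρ₁ ρ₂ : ℝ) (hP : 0 < P) (hPr : 0 < Pr) (hN₀ : 0 < N₀)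
    (hρ₁ : ρ₁ = P / N₀) (hρ₂ : ρ₂ = Pr / N₀)
    (PI : Fin M → ℝ) (hPI : ∀ i, 0 ≤ PI i)
    (h₁ : Ω → Fin N → ℂ) (H : Ω → Matrix (Fin N) (Fin M) ℂ) (h₂ : Ω → Fin N → ℂ)
    (hlaw : ∀ e, HasLaw (channelEntry h₁ H h₂ e) complexNormal μ)
    (hindep : iIndepFun (channelEntry h₁ H h₂) μ)
    (σ τ : ℕ → ℕ → ℝ)
    (hcontour : ∀ k < N - M, ∀ j < N,
      IsMeijerG2Contour 2 (-(k : ℝ)) (-(j : ℝ)) 0 0 (σ k j) (τ k j)) :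
    Integrable (mutualInfo fun ω => zfSINR P Pr N₀ PI (h₁ ω) (H ω) (h₂ ω)) μ ∧
    (∀ k < N - M, ∀ j < N,
      Integrable (meijerG2OnContour (σ k j) (τ k j) 2 (-(k : ℝ)) (-(j : ℝ)) 0 0 ρ₁ ρ₂)) ∧
    (ergodicCapacity μ (fun ω => zfSINR P Pr N₀ PI (h₁ ω) (H ω) (h₂ ω)) : ℂ) =
      1 / (2 * (Real.log 2 : ℂ)) *
        (((∑ k ∈ Finset.range (N - M),
              Real.exp (1 / ρ₁) / ρ₁ ^ k * upperIncompleteGamma (-(k : ℝ)) (1 / ρ₁)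
            + ∑ j ∈ Finset.range N,
              Real.exp (1 / ρ₂) / ρ₂ ^ j * upperIncompleteGamma (-(j : ℝ)) (1 / ρ₂)
            - ∑ k ∈ Finset.range (N - M), tricomiPsi 1 (1 - (k : ℝ)) (1 / ρ₁)
            - ∑ j ∈ Finset.range N, tricomiPsi 1 (1 - (j : ℝ)) (1 / ρ₂) : ℝ) : ℂ)
          + (ρ₁ : ℂ) * (ρ₂ : ℂ) *
            ∑ k ∈ Finset.range (N - M), ∑ j ∈ Finset.range N,
              1 / ((k.factorial : ℂ) * (j.factorial : ℂ)) *
                meijerG2 (σ k j) (τ k j) 2 (-(k : ℝ)) (-(j : ℝ)) 0 0 ρ₁ ρ₂) := by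
  have hr₁ : 0 < ρ₁ := hρ₁ ▸ div_pos hP hN₀
  have hr₂ : 0 < ρ₂ := hρ₂ ▸ div_pos hPr hN₀
  have hX := hasLaw_channel hlaw hindep
  obtain ⟨hint, hval⟩ := integrable_integral_log_one_add_sinr hMN.le hr₁ hr₂
  have hae : (mutualInfo fun ω => zfSINR P Pr N₀ PI (h₁ ω) (H ω) (h₂ ω)) =ᵐ[μ]
      fun ω => (Real.log 2)⁻¹ * (fun p => Real.log (1 +
        (ρ₁ * zfGain p.1 (channelMatrix p.2.1)) * (ρ₂ * normSqF p.2.2) /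
          (1 + ρ₁ * zfGain p.1 (channelMatrix p.2.1) + ρ₂ * normSqF p.2.2)))
        (h₁ ω, ((fun q : Fin N × Fin M => H ω q.1 q.2), h₂ ω)) := by
    -- The closed form of the SINR needs H†H invertible, so it is transferred from the joint channel
    -- law as an almost sure identity.
    have hdet := ae_of_ae_map hX.aemeasurable (hX.map_eq ▸ ae_channelLaw_det_ne_zero hMN.le)
    refine hdet.mono fun ω hω => ?_
    have hz := zfSINR_eq (H := H ω) hω hP hPr hN₀ PI (h₁ ω) (h₂ ω)
    rw [mutualInfo, hz, ← hρ₁, ← hρ₂, Real.logb, div_eq_inv_mul]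
    rfl
  have hcomp := hX.integral_comp hint.aestronglyMeasurable
  have hicomp := (hX.map_eq ▸ hint).comp_aemeasurable hX.aemeasurable
  refine ⟨(hicomp.const_mul _).congr hae.symm, fun k hk j hj =>
    integrable_meijerG2OnContour (hcontour k hk j hj) hr₁ hr₂, ?_⟩
  have hcap : ergodicCapacity μ (fun ω => zfSINR P Pr N₀ PI (h₁ ω) (H ω) (h₂ ω))
      = 1 / (2 * Real.log 2) * (ρ₁ * ρ₂ * ∑ k ∈ Finset.range (N - M), ∑ j ∈ Finset.range N,
        ∫ t in Set.Ioi (0 : ℝ), gainIntegrand ρ₁ ρ₂ k j t) := by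
    rw [ergodicCapacity, integral_congr_ae hae, integral_const_mul, ← hval, ← hcomp,
      one_div, one_div, mul_inv, mul_assoc]
    rfl
  have hPsi : ∀ {ρ : ℝ}, 0 < ρ → ∀ n : ℕ,
      ∑ k ∈ Finset.range n, Real.exp (1 / ρ) / ρ ^ k * upperIncompleteGamma (-(k : ℝ)) (1 / ρ)
        = ∑ k ∈ Finset.range n, tricomiPsi 1 (1 - (k : ℝ)) (1 / ρ) := fun hρ n =>
    -- Each incomplete gamma term equals the Tricomi term of the same index, so the single sums
    -- contribute nothing.
    Finset.sum_congr rfl fun k _ => (tricomiPsi_one_one_sub_natCast k hρ).symm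
  have hzero : ∑ k ∈ Finset.range (N - M),
              Real.exp (1 / ρ₁) / ρ₁ ^ k * upperIncompleteGamma (-(k : ℝ)) (1 / ρ₁)
            + ∑ j ∈ Finset.range N,
              Real.exp (1 / ρ₂) / ρ₂ ^ j * upperIncompleteGamma (-(j : ℝ)) (1 / ρ₂)
            - ∑ k ∈ Finset.range (N - M), tricomiPsi 1 (1 - (k : ℝ)) (1 / ρ₁)
            - ∑ j ∈ Finset.range N, tricomiPsi 1 (1 - (j : ℝ)) (1 / ρ₂) = 0 := by
    rw [hPsi hr₁, hPsi hr₂]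
    ring
  rw [hzero, Complex.ofReal_zero, zero_add, hcap]
  push_cast
  congr 2
  refine Finset.sum_congr rfl fun k hk => Finset.sum_congr rfl fun j hj => ?_
  rw [meijerG2_eq_integral_gainIntegrand
    (hcontour k (Finset.mem_range.1 hk) j (Finset.mem_range.1 hj)) hr₁ hr₂]
  have hk0 : (k.factorial : ℂ) ≠ 0 := by exact_mod_cast k.factorial_ne_zero
  have hj0 : (j.factorial : ℂ) ≠ 0 := by exact_mod_cast j.factorial_ne_zero
  field_simp
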